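/- Let $k\ge 1$. A $\mathrm{nil}(k)$-group is a group $G$ with $\gamma_{k+1}(G)=1$ (where $\gamma_1(G)=G$), and $\mathsf{sNil}^k$ is the category of simplicial $\mathrm{nil}(k)$-groups. A map $f:X\to Z$ in $\mathsf{sNil}^k$ is free on subsets $C_q\subset Z_q$ $(q\ge 0)$ if these subsets are closed under degeneracy operators and if, for each $q$, $Z_q$ is via $f_q$ and the inclusion of $C_q$ the coproduct in the category of $\mathrm{nil}(k)$-groups of $X_q$ and of the free $\mathrm{nil}(k)$-group on $C_q$. Cofibrations are the retracts of free maps, and $X$ is cofibrant if the map from the initial object to $X$ is a cofibration. We say that $Z$ is obtained from $X$ by attaching cells in dimensions $\ge m$ (via $f$) if $f$ is free on some $(C_q)$ with $C_q=\emptyset$ for $q<m$. For a map $f:X\to Y$ of simplicial groups and $r\ge 1$, the relative homotopy group $\pi_r(Y,X)$ is the group of pairs $(x,y)\in Y_r\times X_{r-1}$ such that $d_ix=1$ for $i>0$, $d_0x=f(y)$ and (if $r\geq 2$) $d_iy=1$ for all $i$, modulo the normal subgroup of all pairs $(d_1u,d_0v)$ with $u\in Y_{r+1}$, $v\in X_r$,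 $d_iu=1$ for $i\ge 2$, $d_iv=1$ for $i\ge 1$ and $d_0u=f(v)$; this is the $(r-1)$-st homotopy group of the homotopy fibre of $f$. Moreover $\pi_0(Y,X)$ is the set of cosets $\pi_0(Y)/\operatorname{im}(\pi_0(X))$. Both are functorial in commutative squares. **Theorem.** The Blakers–Massey property holds for $\mathsf{sNil}^k$: let $F$ be a cofibrant object of $\mathsf{sNil}^k$, let $m,n\ge 0$, and let $f_1:F\to M$ and $f_2:F\to N$ be maps in $\mathsf{sNil}^k$ such that $M$ and $N$ are obtained from $F$ by attaching cells in dimensions $\ge m$ and $\ge n$ respectively. Let $M\vee_F N$ be the push-out of $f_1$ and $f_2$ in $\mathsf{sNil}^k$. Then the induced map $$g_r:\pi_r(N,F)\to\pi_r(M\vee_F N,M)$$ is an isomorphism for $0\le r\le n+m-2$ and an epimorphism for $r=n+m-1\ge 0$. (For $r=0$ these words mean bijection and surjection of sets.) -/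

import Mathlib

open CategoryTheory CategoryTheory.Limits Opposite
open scoped Simplicial

universe u

/-! ## Homotopy groups of simplicial groups -/

namespace SGrp

/-- The category of simplicial groups. -/
abbrev SGrpCat := SimplicialObject GrpCat.{u}

/-- The face operator `d_i`, as a group homomorphism. -/
abbrev face (X : SGrpCat.{u}) (n : ℕ) (i : Fin (n + 2)) : X _⦋n + 1⦌ →* X _⦋n⦌ := (X.δ i).hom

/-- The degeneracy operator `s_i`, as a group homomorphism. -/
abbrev degen (X : SGrpCat.{u}) (n : ℕ) (i : Fin (n + 1)) : X _⦋n⦌ →* X _⦋n + 1⦌ := (X.σ i).hom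

/-- The component of a map of simplicial groups in degree `n`. -/
abbrev app {X Y : SGrpCat.{u}} (f : X ⟶ Y) (n : ℕ) : X _⦋n⦌ →* Y _⦋n⦌ := (f.app (op ⦋n⦌)).hom

lemma app_face {X Y : SGrpCat.{u}} (f : X ⟶ Y) (n : ℕ) (i : Fin (n + 2)) (x : X _⦋n + 1⦌) :
    app f n (face X n i x) = face Y n i (app f (n + 1) x) :=
  ConcreteCategory.congr_hom (SimplicialObject.δ_naturality f i).symm x |>.symm

lemma app_degen {X Y : SGrpCat.{u}} (f : X ⟶ Y) (n : ℕ) (i : Fin (n + 1)) (x : X _⦋n⦌) :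
    app f (n + 1) (degen X n i x) = degen Y n i (app f n x) :=
  ConcreteCategory.congr_hom (SimplicialObject.σ_naturality f i).symm x |>.symm

lemma app_comp {X Y Z : SGrpCat.{u}} (f : X ⟶ Y) (g : Y ⟶ Z) (n : ℕ) (x : X _⦋n⦌) :
    app (f ≫ g) n x = app g n (app f n x) := rfl

lemma face_zero_degen_zero (X : SGrpCat.{u}) (n : ℕ) (x : X _⦋n⦌) :
    face X n 0 (degen X n 0 x) = x :=
  ConcreteCategory.congr_hom (X.δ_comp_σ_self (i := (0 : Fin (n + 1)))) x

lemma face_one_degen_one (X : SGrpCat.{u}) (n : ℕ) (x : X _⦋n + 1⦌) :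
    face X (n + 1) 1 (degen X (n + 1) 1 x) = x :=
  ConcreteCategory.congr_hom (X.δ_comp_σ_self (i := (1 : Fin (n + 2)))) x

lemma face_zero_degen_one (X : SGrpCat.{u}) (n : ℕ) (x : X _⦋n + 1⦌) :
    face X (n + 1) 0 (degen X (n + 1) 1 x) = degen X n 0 (face X n 0 x) :=
  ConcreteCategory.congr_hom
    (X.δ_comp_σ_of_le (i := (0 : Fin (n + 2))) (j := (0 : Fin (n + 1))) (by simp)) x

/-- The Moore cycles of a simplicial group in degree `n`: all faces are trivial. -/
def cycles (X : SGrpCat.{u}) (n : ℕ) : Subgroup (X _⦋n⦌) :=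
  match n with
  | 0 => ⊤
  | n + 1 => ⨅ i : Fin (n + 2), (face X n i).ker

/-- The Moore chains of positive degree: `N_{n+1} X = ⋂_{i > 0} ker d_i`. -/
def chains (X : SGrpCat.{u}) (n : ℕ) : Subgroup (X _⦋n + 1⦌) :=
  ⨅ i : Fin (n + 1), (face X n i.succ).ker

/-- The Moore boundaries in degree `n`: the image of `d_0` on `N_{n+1} X`. -/
def boundaries (X : SGrpCat.{u}) (n : ℕ) : Subgroup (X _⦋n⦌) :=
  (chains X n).map (face X n 0)

lemma mem_chains {X : SGrpCat.{u}} {n : ℕ} {x : X _⦋n + 1⦌} :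
    x ∈ chains X n ↔ ∀ i : Fin (n + 1), face X n i.succ x = 1 := by
  simp [chains, Subgroup.mem_iInf, MonoidHom.mem_ker]

lemma mem_cycles_succ {X : SGrpCat.{u}} {n : ℕ} {x : X _⦋n + 1⦌} :
    x ∈ cycles X (n + 1) ↔ ∀ i : Fin (n + 2), face X n i x = 1 := by
  simp [cycles, Subgroup.mem_iInf, MonoidHom.mem_ker]

instance boundaries_normal (X : SGrpCat.{u}) (n : ℕ) : (boundaries X n).Normal := by
  constructor
  rintro _ ⟨w, hw, rfl⟩ g
  refine ⟨degen X n 0 g * w * (degen X n 0 g)⁻¹, ?_, ?_⟩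
  · rw [SetLike.mem_coe, mem_chains] at hw ⊢
    intro i
    rw [map_mul, map_mul, map_inv, hw i, mul_one, mul_inv_cancel]
  · rw [map_mul, map_mul, map_inv, face_zero_degen_zero]

/-- The homotopy group `π_n X` of a simplicial group: Moore cycles modulo Moore boundaries. -/
abbrev HomotopyGroup (X : SGrpCat.{u}) (n : ℕ) : Type u :=
  cycles X n ⧸ (boundaries X n).subgroupOf (cycles X n)

lemma app_mem_cycles {X Y : SGrpCat.{u}} (f : X ⟶ Y) (n : ℕ) {x : X _⦋n⦌} (hx : x ∈ cycles X n) :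
    app f n x ∈ cycles Y n := by
  cases n with
  | zero => exact Subgroup.mem_top _
  | succ n =>
    rw [mem_cycles_succ] at hx ⊢
    intro i
    rw [← app_face, hx i, map_one]

/-- The map on Moore cycles induced by a map of simplicial groups. -/
def cyclesMap {X Y : SGrpCat.{u}} (f : X ⟶ Y) (n : ℕ) : cycles X n →* cycles Y n :=
  ((app f n).comp (cycles X n).subtype).codRestrict (cycles Y n)
    (fun x => app_mem_cycles f n x.2)

/-- The map `π_n X → π_n Y` induced by a map of simplicial groups. -/
def homotopyGroupMap {X Y : SGrpCat.{u}} (f : X ⟶ Y) (n : ℕ) :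
    HomotopyGroup X n →* HomotopyGroup Y n :=
  QuotientGroup.map _ _ (cyclesMap f n) (by
    rintro ⟨x, hx⟩ hb
    obtain ⟨w, hw, hwx⟩ := Subgroup.mem_subgroupOf.1 hb
    refine Subgroup.mem_comap.2 (Subgroup.mem_subgroupOf.2 ⟨app f (n + 1) w, ?_, ?_⟩)
    · rw [SetLike.mem_coe, mem_chains] at hw ⊢
      intro i
      rw [← app_face, hw i, map_one]
    · rw [← app_face, hwx]
      rfl)

/-! ## Relative homotopy groups -/

/-- The cycles representing elements of `π_{n+1}(Y, X)` for a map `f : X ⟶ Y` of simplicial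
groups: pairs of an `(n+1)`-simplex `x` of `Y` with `d_i x = 1` for `i > 0`
and a Moore cycle `y` of degree `n` in `X` with `d_0 x = f y`.
(If `f` is an inclusion, then `y` is determined by `x`.)

Such pairs are the Moore cycles of degree `n` of the homotopy fibre of `f`, whose
`q`-simplices are the pairs `(u, v)` of a `(q+1)`-simplex `u` of `Y` with trivial initial vertex
`d_1 ⋯ d_{q+1} u` and a `q`-simplex `v` of `X`, with `d_0 u = f v`; its `i`-th face is
`(d_{i+1} u, d_i v)`. -/
def relCycles {X Y : SGrpCat.{u}} (f : X ⟶ Y) (n : ℕ) : Subgroup (Y _⦋n + 1⦌ × X _⦋n⦌) where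
  carrier := {p | (∀ i : Fin (n + 1), face Y n i.succ p.1 = 1) ∧
    face Y n 0 p.1 = app f n p.2 ∧ p.2 ∈ cycles X n}
  one_mem' := ⟨fun i => map_one _, by simp, one_mem _⟩
  mul_mem' := by
    rintro p q ⟨hp, hp', hp''⟩ ⟨hq, hq', hq''⟩
    refine ⟨fun i => ?_, ?_, mul_mem hp'' hq''⟩
    · rw [Prod.fst_mul, map_mul, hp i, hq i, mul_one]
    · rw [Prod.fst_mul, Prod.snd_mul, map_mul, map_mul, hp', hq']
  inv_mem' := by
    rintro p ⟨hp, hp', hp''⟩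
    refine ⟨fun i => ?_, ?_, inv_mem hp''⟩
    · rw [Prod.fst_inv, map_inv, hp i, inv_one]
    · rw [Prod.fst_inv, Prod.snd_inv, map_inv, map_inv, hp']

/-- The chains whose boundaries are divided out in `π_{n+1}(Y, X)`: pairs of an `(n+2)`-simplex `u`
of `Y` with `d_i u = 1` for `i > 1` and an `(n+1)`-simplex `v` of `X` with `d_i v = 1` for `i > 0`,
such that `d_0 u = f v`. -/
def relChains {X Y : SGrpCat.{u}} (f : X ⟶ Y) (n : ℕ) :
    Subgroup (Y _⦋n + 2⦌ × X _⦋n + 1⦌) where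
  carrier := {p | (∀ i : Fin (n + 1), face Y (n + 1) i.succ.succ p.1 = 1) ∧
    face Y (n + 1) 0 p.1 = app f (n + 1) p.2 ∧ p.2 ∈ chains X n}
  one_mem' := ⟨fun i => map_one _, by simp, one_mem _⟩
  mul_mem' := by
    rintro p q ⟨hp, hp', hp''⟩ ⟨hq, hq', hq''⟩
    refine ⟨fun i => ?_, ?_, mul_mem hp'' hq''⟩
    · rw [Prod.fst_mul, map_mul, hp i, hq i, mul_one]
    · rw [Prod.fst_mul, Prod.snd_mul, map_mul, map_mul, hp', hq']
  inv_mem' := by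
    rintro p ⟨hp, hp', hp''⟩
    refine ⟨fun i => ?_, ?_, inv_mem hp''⟩
    · rw [Prod.fst_inv, map_inv, hp i, inv_one]
    · rw [Prod.fst_inv, Prod.snd_inv, map_inv, map_inv, hp']

/-- The boundaries `(d_1 u, d_0 v)` of the chains `(u, v)`. -/
def relBoundaries {X Y : SGrpCat.{u}} (f : X ⟶ Y) (n : ℕ) : Subgroup (Y _⦋n + 1⦌ × X _⦋n⦌) :=
  (relChains f n).map ((face Y (n + 1) 1).prodMap (face X n 0))

instance relBoundaries_normal {X Y : SGrpCat.{u}} (f : X ⟶ Y) (n : ℕ) :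
    ((relBoundaries f n).subgroupOf (relCycles f n)).Normal := by
  constructor
  rintro ⟨b, hb⟩ hb' ⟨⟨x, y⟩, hx, hxy, hy⟩
  obtain ⟨⟨a, v⟩, ⟨ha, hav, hv⟩, rfl⟩ := Subgroup.mem_subgroupOf.1 hb'
  refine Subgroup.mem_subgroupOf.2
    ⟨(degen Y (n + 1) 1 x * a * (degen Y (n + 1) 1 x)⁻¹,
      degen X n 0 y * v * (degen X n 0 y)⁻¹), ⟨fun i => ?_, ?_, ?_⟩, ?_⟩
  · have := ha i
    dsimp only at this ⊢
    rw [map_mul, map_mul, map_inv, this, mul_one, mul_inv_cancel]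
  · dsimp only at hav hxy ⊢
    rw [map_mul, map_mul, map_inv, map_mul, map_mul, map_inv, hav, face_zero_degen_one, hxy,
      app_degen]
  · dsimp only at hv ⊢
    rw [mem_chains] at hv ⊢
    intro i
    rw [map_mul, map_mul, map_inv, hv i, mul_one, mul_inv_cancel]
  · simp only [MonoidHom.coe_prodMap, Prod.map_apply, map_mul, map_inv, face_zero_degen_zero,
      face_one_degen_one]
    rfl

/-- `RelHomotopyGroup f n` is the relative homotopy group `π_{n+1}(Y, X)` of `f : X ⟶ Y`. -/
abbrev RelHomotopyGroup {X Y : SGrpCat.{u}} (f : X ⟶ Y) (n : ℕ) : Type u :=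
  relCycles f n ⧸ (relBoundaries f n).subgroupOf (relCycles f n)

section RelMap

variable {X Y X' Y' : SGrpCat.{u}} {f : X ⟶ Y} {f' : X' ⟶ Y'} {a : X ⟶ X'} {b : Y ⟶ Y'}

lemma app_comm (h : CommSq f a b f') (n : ℕ) (x : X _⦋n⦌) :
    app b n (app f n x) = app f' n (app a n x) := by
  rw [← app_comp, h.w, app_comp]

/-- The map on relative cycles induced by a map of pairs. -/
def relCyclesMap (h : CommSq f a b f') (n : ℕ) : relCycles f n →* relCycles f' n :=
  (((app b (n + 1)).prodMap (app a n)).comp (relCycles f n).subtype).codRestrict (relCycles f' n)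
    (by
      rintro ⟨⟨x, y⟩, hx, hxy, hy⟩
      refine ⟨fun i => ?_, ?_, app_mem_cycles a n hy⟩
      · have := hx i
        dsimp only at this
        change face Y' n i.succ (app b (n + 1) x) = 1
        rw [← app_face, this, map_one]
      · change face Y' n 0 (app b (n + 1) x) = app f' n (app a n y)
        dsimp only at hxy
        rw [← app_face, hxy, app_comm h])

/-- The map `π_{n+1}(Y, X) → π_{n+1}(Y', X')` induced by a map of pairs `(b, a)`, that is by a
commutative square `f ≫ b = a ≫ f'`. -/
def relHomotopyGroupMap (h : CommSq f a b f') (n : ℕ) :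
    RelHomotopyGroup f n →* RelHomotopyGroup f' n :=
  QuotientGroup.map _ _ (relCyclesMap h n) (by
    rintro ⟨p, hp⟩ hp'
    obtain ⟨⟨w, v⟩, ⟨hw, hwv, hv⟩, rfl⟩ := Subgroup.mem_subgroupOf.1 hp'
    dsimp only at hw hwv hv
    refine Subgroup.mem_comap.2 (Subgroup.mem_subgroupOf.2
      ⟨(app b (n + 2) w, app a (n + 1) v), ⟨fun i => ?_, ?_, ?_⟩, ?_⟩)
    · change face Y' (n + 1) i.succ.succ (app b (n + 2) w) = 1
      rw [← app_face, hw i, map_one]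
    · change face Y' (n + 1) 0 (app b (n + 2) w) = app f' (n + 1) (app a (n + 1) v)
      rw [← app_face, hwv, app_comm h]
    · change app a (n + 1) v ∈ chains X' n
      rw [mem_chains] at hv ⊢
      intro i
      rw [← app_face, hv i, map_one]
    · change (face Y' (n + 1) 1 (app b (n + 2) w), face X' n 0 (app a (n + 1) v)) =
        (app b (n + 1) (face Y (n + 1) 1 w), app a n (face X n 0 v))
      rw [app_face, app_face])

/-- The set `π_0(Y, X)`: the cosets of the image of `π_0 X` in `π_0 Y`. -/
abbrev RelPiZero (f : X ⟶ Y) : Type u :=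
  HomotopyGroup Y 0 ⧸ (homotopyGroupMap f 0).range

/-- The map of sets `π_0(Y, X) → π_0(Y', X')` induced by a map of pairs. -/
def relPiZeroMap (h : CommSq f a b f') : RelPiZero f → RelPiZero f' :=
  Quotient.map' (homotopyGroupMap b 0) (by
    intro x y hxy
    rw [QuotientGroup.leftRel_apply] at hxy ⊢
    obtain ⟨z, hz⟩ := hxy
    refine ⟨homotopyGroupMap a 0 z, ?_⟩
    rw [← map_inv, ← map_mul, ← hz]
    obtain ⟨z, rfl⟩ := QuotientGroup.mk_surjective z
    exact congrArg QuotientGroup.mk (Subtype.ext (app_comm h 0 z.1).symm))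

end RelMap

end SGrp

/-! ## Simplicial `nil(k)`-groups -/

namespace SNil

open SGrp

/-- A `nil(k)`-group: the term `γ_{k+1}` of the lower central series (`γ_1 = G`) is trivial, that
is all `(k+1)`-fold commutators vanish. Mathlib's series is indexed from `0`. -/
def IsNil (k : ℕ) : ObjectProperty GrpCat.{u} :=
  fun G => (⊤ : Subgroup G).lowerCentralSeries k = ⊥

/-- The category of `nil(k)`-groups, a full subcategory of the category of groups. -/
abbrev NilCat (k : ℕ) := (IsNil.{u} k).FullSubcategory

/-- The category `sNil^k` of simplicial `nil(k)`-groups. -/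
abbrev SNilCat (k : ℕ) := SimplicialObject (NilCat.{u} k)

/-- The forgetful functor from simplicial `nil(k)`-groups to simplicial groups. -/
abbrev forget (k : ℕ) : SNilCat.{u} k ⥤ SGrpCat.{u} :=
  (SimplicialObject.whiskering _ _).obj (IsNil k).ι

/-- The family of subsets `C_q ⊆ Z_q` exhibits `f : X ⟶ Z` as a free map of simplicial
`nil(k)`-groups: it is closed under degeneracy operators, and `Z_q` is the coproduct, in the category
of `nil(k)`-groups, of `X_q` (via `f`) and of the free `nil(k)`-group generated by `C_q`; the latter
is expressed by the universal property. -/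
structure IsFreeMapOn {k : ℕ} {X Z : SNilCat.{u} k} (f : X ⟶ Z)
    (C : ∀ q : ℕ, Set (((forget k).obj Z) _⦋q⦌)) : Prop where
  degen_mem : ∀ ⦃p q : ℕ⦄ (η : ⦋p⦌ ⟶ ⦋q⦌), Function.Surjective η.toOrderHom →
    ∀ c ∈ C q, (((forget k).obj Z).map η.op).hom c ∈ C p
  exists_unique_hom : ∀ (q : ℕ) (H : GrpCat.{u}), IsNil k H →
    ∀ (φ : ((forget k).obj X) _⦋q⦌ →* H) (t : C q → H),
      ∃! ψ : ((forget k).obj Z) _⦋q⦌ →* H,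
        (∀ x, ψ (app ((forget k).map f) q x) = φ x) ∧ ∀ c : C q, ψ c = t c

/-- The free maps of simplicial `nil(k)`-groups. -/
def freeMaps (k : ℕ) : MorphismProperty (SNilCat.{u} k) :=
  fun _ _ f => ∃ C, IsFreeMapOn f C

/-- The cofibrations of `sNil^k`: the retracts of free maps. -/
def cofibrations (k : ℕ) : MorphismProperty (SNilCat.{u} k) := (freeMaps k).retracts

/-- An object is cofibrant if the map from the initial object is a cofibration. -/
def IsCofibrant {k : ℕ} (X : SNilCat.{u} k) : Prop :=
  ∃ (I : SNilCat.{u} k) (hI : IsInitial I), cofibrations k (hI.to X)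

/-- `f : X ⟶ Z` is obtained by attaching cells in dimensions `≥ m`: it is free on generators all of
which have degree `≥ m`. (A `q`-cell is a free generator of degree `q` together with its
degeneracies; its faces are elements of what has been constructed in degree `q - 1`, and they form
the attaching map.) -/
def AttachesCells {k : ℕ} (m : ℕ) {X Z : SNilCat.{u} k} (f : X ⟶ Z) : Prop :=
  ∃ C, IsFreeMapOn f C ∧ ∀ q < m, C q = ∅

end SNil

/-! Let P be the push-out, and regard M, N, F as simplicial subgroups of P. The relative groups are
compared through triad cycles: simplices with zeroth face in M, first face in N and all other faces
trivial. If every triad cycle of degree less than m + n is the second face of a triad chain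
(`SNil.exists_isTriadChain`), then relative cycles and relative chains of (P, M) can be moved into
N, which gives surjectivity and injectivity.

To solve this boundary problem, filter P_q by the smallest central series `W` in which all elements
have weight at least 1 and those of N weight at least 2. Nilpotency makes it end at weight 2k + 1,
so successive approximation suffices: a triad cycle in `W w` must bound modulo `W (w + 1)`. Modulo
the part generated by M, N and `W (w + 1)`, this asks for acyclicity of an abelian graded piece.
What remains inside that part is handled by explicit degeneracies
(`exists_isTriadChain_of_mem_decomposables`).

For the graded pieces, P_q is isomorphic, degree by degree, to the coproduct of M_q / F_q and N_q,
because M_q is the coproduct of F_q and a free group. The isomorphism is not simplicial: an operator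
applied to a generator of M may produce elements of F, which die in M_q / F_q. But F lies in N and
has weight 2, so simplicial operators are respected to first order, and hence exactly on graded
pieces (`mk_eq_mk_of_mem_W`). These pieces are therefore the diagonal of a bisimplicial abelian
group built from the coproducts of M_p / F_p and N_q. It vanishes for p < m, where M_p = F_p, and
for q < n, where N_q = F_q, so its diagonal has no homotopy below degree m + n
(`BiSimp.exists_diag_boundary`). -/

/-! ## Weighted central series -/

namespace WeightedSeries

open Subgroup

/-- The lower central series is multiplicative for commutators. -/
lemma commutator_lowerCentralSeries_le {G : Type*} [Group G] (a b : ℕ) :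
    ⁅(⊤ : Subgroup G).lowerCentralSeries a, (⊤ : Subgroup G).lowerCentralSeries b⁆ ≤
      (⊤ : Subgroup G).lowerCentralSeries (a + b + 1) := by
  induction b generalizing a with
  | zero => exact le_rfl
  | succ b ih =>
    set K := (⊤ : Subgroup G).lowerCentralSeries (a + (b + 1) + 1) with hK
    -- In the quotient by `K`, the three subgroups lemma applies: the induction hypothesis kills the
    -- other two rotations of the triple commutator.
    have key : ∀ A B : Subgroup G, ⁅A, B⁆ ≤ K →
        ⁅A.map (QuotientGroup.mk' K), B.map (QuotientGroup.mk' K)⁆ = ⊥ := by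
      intro A B h
      rw [← map_commutator, eq_bot_iff, map_le_iff_le_comap, MonoidHom.comap_bot,
        QuotientGroup.ker_mk']
      exact h
    have h1 : ⁅⁅(⊤ : Subgroup G), (⊤ : Subgroup G).lowerCentralSeries a⁆,
        (⊤ : Subgroup G).lowerCentralSeries b⁆ ≤ K := by
      rw [commutator_comm ⊤]
      refine (ih (a + 1)).trans (le_of_eq ?_)
      rw [hK, show a + 1 + b + 1 = a + (b + 1) + 1 by omega]
    have h2 : ⁅⁅(⊤ : Subgroup G).lowerCentralSeries a, (⊤ : Subgroup G).lowerCentralSeries b⁆,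
        (⊤ : Subgroup G)⁆ ≤ K := commutator_mono (ih a) le_rfl
    have h3 := commutator_commutator_eq_bot_of_rotate
      (H₁ := ((⊤ : Subgroup G).lowerCentralSeries b).map (QuotientGroup.mk' K))
      (H₂ := (⊤ : Subgroup G).map (QuotientGroup.mk' K))
      (H₃ := ((⊤ : Subgroup G).lowerCentralSeries a).map (QuotientGroup.mk' K))
      (by rw [← map_commutator]; exact key _ _ h1) (by rw [← map_commutator]; exact key _ _ h2)
    rw [← map_commutator, ← map_commutator, eq_bot_iff, map_le_iff_le_comap,
      MonoidHom.comap_bot, QuotientGroup.ker_mk', commutator_comm] at h3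
    exact h3

/-- A descending multiplicative series of normal subgroups of `G` in which the elements of `G` have
weight at least one and those of `B` have weight at least two. -/
structure IsSeries {G : Type*} [Group G] (B : Subgroup G) (V : ℕ → Subgroup G) : Prop where
  normal : ∀ w, (V w).Normal
  succ_le : ∀ w, V (w + 1) ≤ V w
  one_eq : V 1 = ⊤
  le_two : B ≤ V 2
  comm_le : ∀ a b, ⁅V a, V b⁆ ≤ V (a + b)

/-- The smallest series in which the elements of `B` have weight at least two. -/
def W {G : Type*} [Group G] (B : Subgroup G) (w : ℕ) : Subgroup G :=
  sInf {K | ∃ V, IsSeries B V ∧ K = V w}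

section

variable {G H : Type*} [Group G] [Group H] {B : Subgroup G} {B' : Subgroup H}

lemma mem_W {w : ℕ} {x : G} : x ∈ W B w ↔ ∀ V, IsSeries B V → x ∈ V w := by
  rw [W, mem_sInf]
  exact ⟨fun h V hV => h _ ⟨V, hV, rfl⟩, by rintro h _ ⟨V, hV, rfl⟩; exact h V hV⟩

/-- Since `W` is an intersection over all series, any bound on it is proved by exhibiting a single
series; no description of its elements is needed. -/
lemma W_le {V : ℕ → Subgroup G} (hV : IsSeries B V) (w : ℕ) : W B w ≤ V w :=
  fun _ hx => mem_W.1 hx V hV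

lemma isSeries_W (B : Subgroup G) : IsSeries B (W B) where
  normal w := ⟨fun x hx g => mem_W.2 fun V hV => (hV.normal w).conj_mem x (mem_W.1 hx V hV) g⟩
  succ_le w := fun _ hx => mem_W.2 fun V hV => hV.succ_le w (mem_W.1 hx V hV)
  one_eq := eq_top_iff.2 fun _ _ => mem_W.2 fun _ hV => hV.one_eq ▸ mem_top _
  le_two := fun _ hx => mem_W.2 fun _ hV => hV.le_two hx
  comm_le a b := commutator_le.2 fun _ hx _ hy => mem_W.2 fun V hV =>
    hV.comm_le a b (commutator_mem_commutator (mem_W.1 hx V hV) (mem_W.1 hy V hV))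

instance W_normal (w : ℕ) : (W B w).Normal := (isSeries_W B).normal w

lemma W_antitone (B : Subgroup G) : Antitone (W B) :=
  antitone_nat_of_succ_le (isSeries_W B).succ_le

lemma W_one : W B 1 = ⊤ := (isSeries_W B).one_eq

lemma commutator_W_top_le (w : ℕ) : ⁅W B w, ⊤⁆ ≤ W B (w + 1) := by
  have := (isSeries_W B).comm_le w 1
  rwa [W_one] at this

/-- The preimage of a series is a series. -/
lemma W_le_comap (f : G →* H) (hf : B ≤ B'.comap f) (w : ℕ) : W B w ≤ (W B' w).comap f := by
  refine W_le (V := fun w => (W B' w).comap f) ⟨fun w => inferInstance,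
    fun w => comap_mono ((isSeries_W B').succ_le w), by simp [W_one],
    hf.trans (comap_mono (isSeries_W B').le_two), fun a b => ?_⟩ w
  rw [← map_le_iff_le_comap, map_commutator]
  exact (commutator_mono (map_comap_le _ _) (map_comap_le _ _)).trans ((isSeries_W B').comm_le a b)

lemma map_mem_W (f : G →* H) (hf : ∀ x ∈ B, f x ∈ B') {w : ℕ} {x : G} (hx : x ∈ W B w) :
    f x ∈ W B' w :=
  W_le_comap f hf w hx

lemma commute_mk_of_mem {a b c : ℕ} (h : c ≤ a + b) {x y : H} (hx : x ∈ W B' a) (hy : y ∈ W B' b) :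
    Commute (x : H ⧸ W B' c) (y : H ⧸ W B' c) := by
  rw [← commutatorElement_eq_one_iff_commute]
  change QuotientGroup.mk' _ _ = _
  rw [← MonoidHom.mem_ker, QuotientGroup.ker_mk']
  exact W_antitone B' h ((isSeries_W B').comm_le a b (commutator_mem_commutator hx hy))

/-- Homomorphisms which agree to first order on `G` and on `B` agree to first order on the whole
weighted series. -/
lemma mk_eq_mk_of_mem_W (f g : G →* H) (hf : ∀ x ∈ B, f x ∈ B')
    (hg : ∀ x, (f x : H ⧸ W B' 2) = g x) (hB : ∀ x ∈ B, f x = g x) {w : ℕ} {x : G}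
    (hx : x ∈ W B w) : (f x : H ⧸ W B' (w + 1)) = g x := by
  have hg' : ∀ x ∈ B, g x ∈ B' := fun x hx => hB x hx ▸ hf x hx
  -- The elements of weight `w` on which `f` and `g` agree modulo weight `w + 1` again form a
  -- series, so by minimality they exhaust `W B w`.
  let V : ℕ → Subgroup G := fun w => W B w ⊓
    ((QuotientGroup.mk' (W B' (w + 1))).comp f).eqLocus ((QuotientGroup.mk' (W B' (w + 1))).comp g)
  have memV : ∀ {w x}, x ∈ V w ↔ x ∈ W B w ∧ (f x : H ⧸ W B' (w + 1)) = g x := by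
    intro w x
    exact Iff.rfl
  suffices hV : IsSeries B V from (memV.1 (W_le hV w hx)).2
  refine ⟨fun w => ⟨fun x hx y => ?_⟩, fun w x hx => ?_, ?_, fun x hx => ?_, fun a b => ?_⟩
  · rw [memV] at hx ⊢
    refine ⟨(isSeries_W B).normal w |>.conj_mem x hx.1 y, ?_⟩
    have h1 := commute_mk_of_mem (c := w + 1) (by omega) (W_one (B := B') ▸ mem_top (f y))
      (map_mem_W f hf hx.1)
    have h2 := commute_mk_of_mem (c := w + 1) (by omega) (W_one (B := B') ▸ mem_top (g y))
      (map_mem_W g hg' hx.1)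
    simp only [map_mul, map_inv, QuotientGroup.mk_mul, QuotientGroup.mk_inv]
    rw [h1.eq, h2.eq, mul_inv_cancel_right, mul_inv_cancel_right, hx.2]
  · rw [memV] at hx ⊢
    refine ⟨(isSeries_W B).succ_le w hx.1, ?_⟩
    have := hx.2
    rw [QuotientGroup.eq] at this ⊢
    exact (isSeries_W B').succ_le _ this
  · exact eq_top_iff.2 fun x _ => memV.2 ⟨W_one (B := B) ▸ mem_top x, hg x⟩
  · exact memV.2 ⟨(isSeries_W B).le_two hx, by rw [hB x hx]⟩
  · refine commutator_le.2 fun x hx y hy => ?_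
    rw [memV] at hx hy ⊢
    refine ⟨(isSeries_W B).comm_le a b (commutator_mem_commutator hx.1 hy.1), ?_⟩
    -- The errors `u` and `v` are one step deeper than expected, so modulo weight `a + b + 1` they
    -- commute with the other entry and drop out of the commutator.
    obtain ⟨u, hu, hfx⟩ : ∃ u ∈ W B' (a + 1), f x = g x * u :=
      ⟨(g x)⁻¹ * f x, QuotientGroup.eq.1 hx.2.symm, by group⟩
    obtain ⟨v, hv, hfy⟩ : ∃ v ∈ W B' (b + 1), f y = g y * v :=
      ⟨(g y)⁻¹ * f y, QuotientGroup.eq.1 hy.2.symm, by group⟩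
    have h1 := commute_mk_of_mem (c := a + b + 1) (by omega) hu (map_mem_W f hf hy.1)
    have h2 := commute_mk_of_mem (c := a + b + 1) (by omega) (map_mem_W g hg' hx.1) hv
    simp only [commutatorElement_def, map_mul, map_inv, QuotientGroup.mk_mul,
      QuotientGroup.mk_inv]
    have e1 : ((f x : H) : H ⧸ W B' (a + b + 1)) = g x * u := by rw [hfx, QuotientGroup.mk_mul]
    have e2 : ((f y : H) : H ⧸ W B' (a + b + 1)) = g y * v := by rw [hfy, QuotientGroup.mk_mul]
    calc ((f x : H) : H ⧸ W B' (a + b + 1)) * f y * (f x : H ⧸ W B' (a + b + 1))⁻¹ *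
          (f y : H ⧸ W B' (a + b + 1))⁻¹
        = g x * (u * f y) * (u : H ⧸ W B' (a + b + 1))⁻¹ * (g x : H ⧸ W B' (a + b + 1))⁻¹ *
          (f y : H ⧸ W B' (a + b + 1))⁻¹ := by rw [e1]; group
      _ = g x * f y * (g x : H ⧸ W B' (a + b + 1))⁻¹ * (f y : H ⧸ W B' (a + b + 1))⁻¹ := by
          rw [h1.eq]; group
      _ = g x * g y * (v * (g x : H ⧸ W B' (a + b + 1))⁻¹) * (v : H ⧸ W B' (a + b + 1))⁻¹ *
          (g y : H ⧸ W B' (a + b + 1))⁻¹ := by rw [e2]; group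
      _ = _ := by rw [← h2.inv_left.eq]; group

/-- The weighted series of a nilpotent group terminates. -/
lemma W_eq_bot {k : ℕ} (hG : (⊤ : Subgroup G).lowerCentralSeries k = ⊥) : W B (2 * k + 1) = ⊥ := by
  -- This series gives every element weight 2. At weight `2 * k + 1` it reaches the trivial term of
  -- index `k`.
  have key : IsSeries B fun w => (⊤ : Subgroup G).lowerCentralSeries ((w - 1) / 2) := by
    refine ⟨fun w => inferInstance, fun w => Subgroup.lowerCentralSeries_antitone _ (by omega), rfl,
      le_top, fun a b => ?_⟩
    rcases Nat.eq_zero_or_pos a with rfl | ha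
    · rw [zero_add]
      exact commutator_le_right _ _
    rcases Nat.eq_zero_or_pos b with rfl | hb
    · exact commutator_le_left _ _
    exact (commutator_lowerCentralSeries_le _ _).trans (Subgroup.lowerCentralSeries_antitone _ (by omega))
  have := W_le key (2 * k + 1)
  rw [eq_bot_iff]
  refine this.trans (le_of_eq ?_)
  simpa using hG

end

end WeightedSeries

/-! ## Simplicial groups as families indexed by natural numbers -/

/-- The face and degeneracy operators of a simplicial group, indexed by natural numbers; face
operators out of range are trivial. -/
structure NSimp (X : ℕ → Type*) [∀ n, Group (X n)] where
  /-- the face operators -/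
  d : ∀ n, ℕ → X (n + 1) →* X n
  /-- the degeneracy operators -/
  s : ∀ n, ℕ → X n →* X (n + 1)
  d_of_lt : ∀ n i x, n + 1 < i → d n i x = 1
  d_d : ∀ n i j x, i ≤ j → d n i (d (n + 1) (j + 1) x) = d n j (d (n + 1) i x)
  d_s_of_le : ∀ n i j x, i ≤ j → j ≤ n → d (n + 1) i (s (n + 1) (j + 1) x) = s n j (d n i x)
  d_s_self : ∀ n j x, j ≤ n → d n j (s n j x) = x
  d_s_succ : ∀ n j x, j ≤ n → d n (j + 1) (s n j x) = x
  d_s_of_gt : ∀ n i j x, j < i → j ≤ n → d (n + 1) (i + 1) (s (n + 1) j x) = s n j (d n i x)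

namespace NSimp

section

variable {X : ℕ → Type*} [∀ n, Group (X n)] (S : NSimp X)

/-- The `i`-th face of `x` lies in the family `K` of subgroups; no condition in degree `0`. -/
def FaceIn (K : ∀ n, Subgroup (X n)) (i : ℕ) {n : ℕ} (x : X n) : Prop :=
  match n, x with
  | 0, _ => True
  | n + 1, x => S.d n i x ∈ K n

/-- This packages `d_{i+1} s_j = s_j d_i` so that degree 0 and faces out of range need no separate
treatment. -/
lemma d_s_mem {K : ∀ n, Subgroup (X n)} (hK : ∀ n i x, i ≤ n → x ∈ K n → S.s n i x ∈ K (n + 1))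
    {n i j : ℕ} {x : X n} (h : S.FaceIn K i x) (hj : j < i) (hjn : j ≤ n) :
    S.d n (i + 1) (S.s n j x) ∈ K n := by
  cases n with
  | zero => rw [S.d_of_lt _ _ _ (by omega)]; exact one_mem _
  | succ n =>
    rcases Nat.lt_or_ge n j with hn | hn
    · obtain rfl : j = n + 1 := by omega
      rw [S.d_of_lt _ _ _ (by omega)]
      exact one_mem _
    · rw [S.d_s_of_gt _ _ _ _ hj hn]
      exact hK _ _ _ hn h

lemma d_s_mem' {K : ∀ n, Subgroup (X n)} (hK : ∀ n i x, i ≤ n → x ∈ K n → S.s n i x ∈ K (n + 1))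
    {n i j : ℕ} {x : X n} (h : S.FaceIn K i x) (hj : i ≤ j) (hjn : j + 1 ≤ n) :
    S.d n i (S.s n (j + 1) x) ∈ K n := by
  cases n with
  | zero => omega
  | succ n =>
    rw [S.d_s_of_le _ _ _ _ hj (by omega)]
    exact hK _ _ _ (by omega) h

/-- If the faces of `v` from the `t`-th on are in `K`, then `v` may be changed by an element of
`K` so that these faces become trivial. -/
lemma exists_mul_faces_eq_one {K : ∀ n, Subgroup (X n)}
    (hKd : ∀ n i x, x ∈ K (n + 1) → S.d n i x ∈ K n)
    (hKs : ∀ n i x, i ≤ n → x ∈ K n → S.s n i x ∈ K (n + 1)) {t : ℕ} (ht : 1 ≤ t) {n : ℕ} (v : X n)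
    (hv : ∀ i, t ≤ i → S.FaceIn K i v) :
    ∃ κ ∈ K n, ∀ i, t ≤ i → S.FaceIn (fun _ => ⊥) i (v * κ) := by
  cases n with
  | zero => exact ⟨1, one_mem _, fun _ _ => trivial⟩
  | succ n =>
    -- Faces are made trivial from the top downwards; `j` counts those already treated.
    suffices h : ∀ j, ∃ κ ∈ K (n + 1), ∀ i, t ≤ i → n + 2 ≤ i + j → S.d n i (v * κ) = 1 by
      obtain ⟨κ, hκ, h⟩ := h (n + 2)
      exact ⟨κ, hκ, fun i hi => h i hi (by omega)⟩
    intro j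
    induction j with
    | zero => exact ⟨1, one_mem _, fun i _ hi => S.d_of_lt _ _ _ (by omega)⟩
    | succ j ih =>
      obtain ⟨κ, hκ, h⟩ := ih
      by_cases hj : t + j ≤ n + 1
      · obtain ⟨l, hl⟩ : ∃ l, l + 1 + j = n + 1 := ⟨n - j, by omega⟩
        -- The degeneracy `s_l` of the face `d_{l+1}` has that same face, and its higher faces are
        -- degeneracies of trivial elements. The bound `1 ≤ t` ensures that every index treated has
        -- the form `l + 1`.
        refine ⟨κ * (S.s n l (S.d n (l + 1) (v * κ)))⁻¹, mul_mem hκ (inv_mem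
          (hKs _ _ _ (by omega) ?_)), fun i hi hij => ?_⟩
        · rw [map_mul]
          exact mul_mem (hv _ (by omega)) (hKd _ _ _ hκ)
        · rw [← mul_assoc, map_mul, map_inv]
          rcases Nat.lt_or_ge (l + 1) i with hli | hli
          · obtain ⟨i, rfl⟩ : ∃ i', i = i' + 1 := ⟨i - 1, by omega⟩
            rw [h _ hi (by omega), one_mul, inv_eq_one]
            refine Subgroup.mem_bot.1 (S.d_s_mem (K := fun _ => ⊥) ?_ ?_ (by omega) (by omega))
            · rintro n i x - hx
              rw [Subgroup.mem_bot] at hx ⊢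
              rw [hx, map_one]
            · cases n with
              | zero => trivial
              | succ n =>
                change _ = (1 : X n)
                rw [← S.d_d _ _ _ _ (by omega), h _ hi (by omega), map_one]
          · obtain rfl : i = l + 1 := by omega
            rw [S.d_s_succ _ _ _ (by omega), mul_inv_cancel]
      · exact ⟨κ, hκ, fun i hi hij => h i hi (by omega)⟩

/-- The iterated operator `s_a ^ j * d_{a+1} ^ j`, trivial in low degrees. -/
def collapse (a : ℕ) (j n : ℕ) : X n →* X n :=
  match j, n with
  | 0, _ => MonoidHom.id _
  | _ + 1, 0 => 1
  | j + 1, n + 1 => (S.s n a).comp ((collapse a j n).comp (S.d n (a + 1)))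

lemma collapse_zero (a n : ℕ) (x : X n) : S.collapse a 0 n x = x := by
  cases n <;> rfl

lemma collapse_succ (a j n : ℕ) (x : X (n + 1)) :
    S.collapse a (j + 1) (n + 1) x = S.s n a (S.collapse a j n (S.d n (a + 1) x)) := rfl

/-! ### Faces of the operators `s_a ^ j d_{a+1} ^ j` when all degrees up to `a` are trivial. -/

section Collapse

variable {a : ℕ} (ha : ∀ n ≤ a, Subsingleton (X n))
include ha

lemma d_collapse_of_lt {i j n : ℕ} (hij : i ≤ j) (x : X (n + 1)) :
    S.d n (a + 1 + i) (S.collapse a (j + 1) (n + 1) x) =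
      S.collapse a j n (S.d n (a + 1 + i) x) := by
  induction i generalizing j n with
  | zero =>
    rcases Nat.lt_or_ge a n with hn | hn
    · rw [collapse_succ, add_zero, S.d_s_succ _ _ _ (by omega)]
    · have := ha n hn
      exact Subsingleton.elim _ _
  | succ i ih =>
    rcases Nat.lt_or_ge a n with hn | hn
    · obtain ⟨n, rfl⟩ : ∃ n', n = n' + 1 := ⟨n - 1, by omega⟩
      obtain ⟨j, rfl⟩ : ∃ j', j = j' + 1 := ⟨j - 1, by omega⟩
      rw [collapse_succ, ← add_assoc, S.d_s_of_gt _ _ _ _ (by omega) (by omega), ih (by omega),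
        collapse_succ, S.d_d _ (a + 1) (a + 1 + i) _ (by omega)]
    · have := ha n hn
      exact Subsingleton.elim _ _

lemma d_collapse_of_ge {i j n : ℕ} (hij : j ≤ i) (x : X (n + 1)) :
    S.d n (a + 1 + i) (S.collapse a j (n + 1) x) =
      S.collapse a j n (S.d n (a + 1 + i) x) := by
  induction j generalizing i n with
  | zero => rw [collapse_zero, collapse_zero]
  | succ j ih =>
    rcases Nat.lt_or_ge a n with hn | hn
    · obtain ⟨n, rfl⟩ : ∃ n', n = n' + 1 := ⟨n - 1, by omega⟩
      obtain ⟨i, rfl⟩ : ∃ j', i = j' + 1 := ⟨i - 1, by omega⟩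
      rw [collapse_succ, ← add_assoc, S.d_s_of_gt _ _ _ _ (by omega) (by omega), ih (by omega),
        collapse_succ, S.d_d _ (a + 1) (a + 1 + i) _ (by omega)]
    · have := ha n hn
      exact Subsingleton.elim _ _

/-- Moving `d_{a+1+i}` past a factor `d_{a+1}` lowers its index by one, so after `i ≤ j` moves it
has become one more `d_{a+1}`. -/
lemma collapse_d {i j n : ℕ} (hij : i ≤ j) (x : X (n + 1)) :
    S.collapse a j n (S.d n (a + 1 + i) x) = S.collapse a j n (S.d n (a + 1) x) := by
  induction i generalizing j n with
  | zero => rfl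
  | succ i ih =>
    rcases Nat.lt_or_ge a n with hn | hn
    · obtain ⟨n, rfl⟩ : ∃ n', n = n' + 1 := ⟨n - 1, by omega⟩
      obtain ⟨j, rfl⟩ : ∃ j', j = j' + 1 := ⟨j - 1, by omega⟩
      rw [collapse_succ, collapse_succ, ← add_assoc, S.d_d _ _ _ _ (by omega), ih (by omega)]
    · have := ha n hn
      exact Subsingleton.elim _ _

/-- The `j` faces lead down to a degree at most `a`, where the group is trivial, unless degree 0 is
passed and the operator is trivial by definition. -/
lemma collapse_eq_one {j n : ℕ} (hn : n ≤ a + j) (x : X n) : S.collapse a j n x = 1 := by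
  induction j generalizing n with
  | zero =>
    have := ha n (by omega)
    exact Subsingleton.elim _ _
  | succ j ih =>
    cases n with
    | zero => rfl
    | succ n => rw [collapse_succ, ih (by omega), map_one]

lemma d_collapse_eq_one {i j n : ℕ} (hi : i < a) (x : X (n + 1)) (hx : S.d n i x = 1) :
    S.d n i (S.collapse a j (n + 1) x) = 1 := by
  induction j generalizing n with
  | zero => rwa [collapse_zero]
  | succ j ih =>
    rcases Nat.lt_or_ge a n with hn | hn
    · obtain ⟨n, rfl⟩ : ∃ n', n = n' + 1 := ⟨n - 1, by omega⟩
      obtain ⟨b, rfl⟩ : ∃ b, a = b + 1 := ⟨a - 1, by omega⟩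
      rw [collapse_succ, S.d_s_of_le _ _ _ _ (by omega) (by omega), ih, map_one]
      rw [S.d_d _ _ _ _ (by omega), hx, map_one]
    · have := ha n hn
      exact Subsingleton.elim _ _

lemma d_s_collapse_of_lt {i j n : ℕ} (hij : i ≤ j) (x : X (n + 1)) :
    S.d (n + 1) (a + 1 + i) (S.s (n + 1) a (S.collapse a (j + 1) (n + 1) x)) =
      S.s n a (S.collapse a j n (S.d n (a + 1 + i) x)) := by
  rcases Nat.lt_or_ge a (n + 1) with hn | hn
  · cases i with
    | zero => rw [add_zero, S.d_s_succ _ _ _ (by omega), collapse_succ]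
    | succ i =>
      rw [← add_assoc, S.d_s_of_gt _ _ _ _ (by omega) (by omega), S.d_collapse_of_lt ha (by omega),
        S.collapse_d ha (by omega), add_assoc, S.collapse_d ha (by omega)]
  · have := ha (n + 1) hn
    exact Subsingleton.elim _ _

lemma d_s_collapse_of_gt {i j n : ℕ} (hij : j ≤ i) (x : X (n + 1)) :
    S.d (n + 1) (a + 1 + i + 1) (S.s (n + 1) a (S.collapse a j (n + 1) x)) =
      S.s n a (S.collapse a j n (S.d n (a + 1 + i) x)) := by
  rcases Nat.lt_or_ge a (n + 1) with hn | hn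
  · rw [S.d_s_of_gt _ _ _ _ (by omega) (by omega), S.d_collapse_of_ge ha hij]
  · have := ha (n + 1) hn
    exact Subsingleton.elim _ _

lemma d_s_collapse_self {j n : ℕ} (hn : a ≤ n) (x : X n) :
    S.d n (a + 1 + j) (S.s n a (S.collapse a j n x)) = S.collapse a j n x := by
  cases j with
  | zero => rw [add_zero, S.d_s_succ _ _ _ hn]
  | succ j =>
    cases n with
    | zero =>
      have := ha 0 (by omega)
      exact Subsingleton.elim _ _
    | succ n =>
      rcases Nat.lt_or_ge a (n + 1) with hn | hn
      · rw [← add_assoc, S.d_s_of_gt _ _ _ _ (by omega) (by omega), S.d_collapse_of_lt ha le_rfl,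
          S.collapse_d ha le_rfl, collapse_succ]
      · have := ha (n + 1) hn
        exact Subsingleton.elim _ _

lemma d_s_collapse_succ {j n : ℕ} (x : X (n + 1)) :
    S.d (n + 1) (a + 1 + j + 1) (S.s (n + 1) a (S.collapse a j (n + 1) x)) =
      S.collapse a (j + 1) (n + 1) x := by
  rw [S.d_s_collapse_of_gt ha le_rfl, S.collapse_d ha le_rfl, collapse_succ]

end Collapse

end

end NSimp

/-! ## Connectivity of the diagonal of a bisimplicial abelian group -/

/-- The operators of a bisimplicial abelian group. -/
structure BiSimp (X : ℕ → ℕ → Type*) [∀ p q, CommGroup (X p q)] where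
  /-- the horizontal operators -/
  hor : ∀ q, NSimp (fun p => X p q)
  /-- the vertical operators -/
  ver : ∀ p, NSimp (fun q => X p q)
  d_d : ∀ p q i j x, (hor q).d p i ((ver (p + 1)).d q j x) = (ver p).d q j ((hor (q + 1)).d p i x)
  d_s : ∀ p q i j x, (hor (q + 1)).d p i ((ver (p + 1)).s q j x) =
    (ver p).s q j ((hor q).d p i x)
  s_d : ∀ p q i j x, (hor q).s p i ((ver p).d q j x) = (ver (p + 1)).d q j ((hor (q + 1)).s p i x)

namespace BiSimp

variable {X : ℕ → ℕ → Type*} [∀ p q, CommGroup (X p q)] (S : BiSimp X)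

lemma collapse_d (a j p q i : ℕ) (x : X p (q + 1)) :
    (S.hor q).collapse a j p ((S.ver p).d q i x) =
      (S.ver p).d q i ((S.hor (q + 1)).collapse a j p x) := by
  induction j generalizing p with
  | zero => rw [NSimp.collapse_zero, NSimp.collapse_zero]
  | succ j ih =>
    cases p with
    | zero => exact (map_one _).symm
    | succ p => rw [NSimp.collapse_succ, NSimp.collapse_succ, S.d_d, ih, S.s_d]

/-- The `i`-th diagonal face, formed with the horizontal faces shifted by `a`, is trivial. -/
def DiagFaceEqOne (a i : ℕ) {p r : ℕ} (x : X p r) : Prop :=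
  match r, x with
  | 0, _ => True
  | r + 1, x => (S.hor r).FaceIn (fun _ => ⊥) (a + i) ((S.ver p).d r i x)

/-! ### Contractibility of the horizontal décalage. -/

section Contraction

variable {a : ℕ} (ha : ∀ p ≤ a, ∀ q, Subsingleton (X p q))

/-- The `j`-th component of the contraction of the decalage. -/
def prism (a j p r : ℕ) : X (p + 1) r →* X (p + 2) (r + 1) :=
  ((S.hor (r + 1)).s (p + 1) a).comp
    (((S.hor (r + 1)).collapse a j (p + 1)).comp ((S.ver (p + 1)).s r j))

lemma d_d_prism (j p r i : ℕ) (y : X (p + 1) r) :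
    (S.hor r).d (p + 1) (a + 1 + i) ((S.ver (p + 2)).d r i (S.prism a j p r y)) =
      (S.hor r).d (p + 1) (a + 1 + i) ((S.hor r).s (p + 1) a ((S.hor r).collapse a j (p + 1)
        ((S.ver (p + 1)).d r i ((S.ver (p + 1)).s r j y)))) := by
  rw [S.collapse_d, S.s_d]
  rfl

include ha

/-- The faces `j` and `j + 1` of the `j`-th prism are consecutive collapses of `y`. Consequently
alternating products of prisms telescope. -/
lemma d_d_prism_self {j p r : ℕ} (hj : j ≤ r) (hp : a ≤ p + 1) (y : X (p + 1) r) :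
    (S.hor r).d (p + 1) (a + 1 + j) ((S.ver (p + 2)).d r j (S.prism a j p r y)) =
      (S.hor r).collapse a j (p + 1) y := by
  rw [d_d_prism, (S.ver (p + 1)).d_s_self _ _ _ hj,
    (S.hor r).d_s_collapse_self (fun n hn => ha n hn r) hp]

lemma d_d_prism_succ {j p r : ℕ} (hj : j ≤ r) (y : X (p + 1) r) :
    (S.hor r).d (p + 1) (a + 1 + (j + 1)) ((S.ver (p + 2)).d r (j + 1) (S.prism a j p r y)) =
      (S.hor r).collapse a (j + 1) (p + 1) y := by
  rw [d_d_prism, (S.ver (p + 1)).d_s_succ _ _ _ hj, ← add_assoc (a + 1),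
    (S.hor r).d_s_collapse_succ (fun n hn => ha n hn r)]

/-- Every other face of a prism factors through a diagonal face of `y`. -/
lemma d_d_prism_of_ne {i j p r : ℕ} (hj : j ≤ r) (hij : i ≠ j) (hij' : i ≠ j + 1) (y : X (p + 1) r)
    (hy : ∀ i, S.DiagFaceEqOne (a + 1) i y) :
    (S.hor r).d (p + 1) (a + 1 + i) ((S.ver (p + 2)).d r i (S.prism a j p r y)) = 1 := by
  rw [d_d_prism]
  rcases Nat.lt_or_ge (r + 1) i with hi | hi
  · rw [(S.ver (p + 1)).d_of_lt _ _ _ hi, map_one, map_one, map_one]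
  obtain ⟨r, rfl⟩ : ∃ r', r = r' + 1 := ⟨r - 1, by omega⟩
  have hy' : ∀ i, (S.hor r).d p (a + 1 + i) ((S.ver (p + 1)).d r i y) = 1 := hy
  rcases Nat.lt_or_ge i j with h | h
  · obtain ⟨j, rfl⟩ : ∃ j', j = j' + 1 := ⟨j - 1, by omega⟩
    rw [(S.ver (p + 1)).d_s_of_le _ _ _ _ (by omega) (by omega),
      (S.hor (r + 1)).d_s_collapse_of_lt (fun n hn => ha n hn _) (by omega), S.d_s, hy',
      map_one, map_one, map_one]
  · obtain ⟨i, rfl⟩ : ∃ i', i = i' + 1 := ⟨i - 1, by omega⟩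
    rw [(S.ver (p + 1)).d_s_of_gt _ _ _ _ (by omega) (by omega), ← add_assoc (a + 1),
      (S.hor (r + 1)).d_s_collapse_of_gt (fun n hn => ha n hn _) (by omega), S.d_s, hy',
      map_one, map_one, map_one]

lemma hor_d_prism {i j p r : ℕ} (hi : i < a) (hp : a ≤ p + 1) (y : X (p + 1) r)
    (hy : ∀ i < a, (S.hor r).d p i y = 1) :
    (S.hor (r + 1)).d (p + 1) i (S.prism a j p r y) = 1 := by
  obtain ⟨b, rfl⟩ : ∃ b, a = b + 1 := ⟨a - 1, by omega⟩
  change (S.hor (r + 1)).d (p + 1) i ((S.hor (r + 1)).s (p + 1) (b + 1) _) = 1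
  rw [(S.hor (r + 1)).d_s_of_le _ _ _ _ (by omega) (by omega),
    MonoidHom.comp_apply, (S.hor (r + 1)).d_collapse_eq_one (fun n hn => ha n hn _) hi, map_one]
  rw [S.d_s, hy i hi, map_one]

lemma exists_contraction {p r : ℕ} (hp : p = a + r) (y : X (p + 1) r)
    (hy : ∀ i < a, (S.hor r).d p i y = 1) (hy' : ∀ i, S.DiagFaceEqOne (a + 1) i y) :
    ∃ U : X (p + 2) (r + 1), (∀ i < a, (S.hor (r + 1)).d (p + 1) i U = 1) ∧
      (S.hor r).d (p + 1) (a + 1) ((S.ver (p + 2)).d r 0 U) = y ∧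
      ∀ i, 1 ≤ i → (S.hor r).d (p + 1) (a + 1 + i) ((S.ver (p + 2)).d r i U) = 1 := by
  -- `U` is the alternating product of the prisms of index at most `j`: only its zeroth and last
  -- faces survive. The sign of the zeroth one is left open, as `U` may be inverted at the end.
  have key : ∀ j ≤ r, ∃ U : X (p + 2) (r + 1), (∀ i < a, (S.hor (r + 1)).d (p + 1) i U = 1) ∧
      ((S.hor r).d (p + 1) (a + 1) ((S.ver (p + 2)).d r 0 U) = y ∨
        (S.hor r).d (p + 1) (a + 1) ((S.ver (p + 2)).d r 0 U) = y⁻¹) ∧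
      ∀ i, 1 ≤ i → (S.hor r).d (p + 1) (a + 1 + i) ((S.ver (p + 2)).d r i U) =
        if i = j + 1 then (S.hor r).collapse a (j + 1) (p + 1) y else 1 := by
    intro j hj
    induction j with
    | zero =>
      refine ⟨S.prism a 0 p r y, fun i hi => S.hor_d_prism ha hi (by omega) y hy, Or.inl ?_,
        fun i hi => ?_⟩
      · have := S.d_d_prism_self ha (j := 0) (Nat.zero_le r) (by omega) y
        rwa [NSimp.collapse_zero] at this
      · split_ifs with h
        · subst h
          exact S.d_d_prism_succ ha hj y
        · exact S.d_d_prism_of_ne ha hj (by omega) h y hy'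
    | succ j ih =>
      obtain ⟨U, hU, hU₀, hU₁⟩ := ih (by omega)
      have h₀ := S.d_d_prism_of_ne ha (i := 0) hj (by omega) (by omega) y hy'
      rw [add_zero] at h₀
      refine ⟨S.prism a (j + 1) p r y * U⁻¹, fun i hi => ?_, ?_, fun i hi => ?_⟩
      · rw [map_mul, map_inv, S.hor_d_prism ha hi (by omega) y hy, hU i hi, inv_one, mul_one]
      · simp only [map_mul, map_inv, h₀, one_mul]
        rcases hU₀ with h | h
        · exact Or.inr (by rw [h])
        · exact Or.inl (by rw [h, inv_inv])
      · simp only [map_mul, map_inv, hU₁ i hi]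
        rcases eq_or_ne i (j + 1) with rfl | h
        · rw [S.d_d_prism_self ha hj (by omega), if_pos rfl, mul_inv_cancel, if_neg (by omega)]
        · rw [if_neg h, inv_one, mul_one]
          split_ifs with h'
          · subst h'
            exact S.d_d_prism_succ ha hj y
          · exact S.d_d_prism_of_ne ha hj h h' y hy'
  obtain ⟨U, hU, hU₀, hU₁⟩ := key r le_rfl
  have hc : (S.hor r).collapse a (r + 1) (p + 1) y = 1 :=
    (S.hor r).collapse_eq_one (fun n hn => ha n hn r) (by omega) y
  simp only [hc, ite_self] at hU₁
  rcases hU₀ with h | h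
  · exact ⟨U, hU, h, hU₁⟩
  · refine ⟨U⁻¹, fun i hi => ?_, ?_, fun i hi => ?_⟩
    · rw [map_inv, hU i hi, inv_one]
    · rw [map_inv, map_inv, h, inv_inv]
    · rw [map_inv, map_inv, hU₁ i hi, inv_one]

end Contraction

variable {m n : ℕ} (hX : ∀ p q, p < m ∨ q < n → Subsingleton (X p q))
include hX

/-- Let Y^a be the simplicial group with Y^a_r the subgroup of `X (a + r) r` where the horizontal
faces of index below `a` vanish, with operators diagonal after a horizontal shift by `a`. The
horizontal face `d_a` maps a décalage, made of elements of `X (a + 1 + r) r`, to Y^a with kernel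
Y^{a+1}. For `a < m` the décalage is contractible, so the degree r homotopy of Y^a is governed by
the degree r - 1 homotopy of Y^{a+1}. The induction descends from `a = m`, where `r < n` makes `X p
r` trivial. -/
lemma exists_loop_boundary (a : ℕ) (ham : a ≤ m) (p r : ℕ) (hr : r + a < m + n) (hp : p = a + r)
    (x : X p r) (hx : ∀ i < a, (S.hor r).FaceIn (fun _ => ⊥) i x)
    (hx' : ∀ i, S.DiagFaceEqOne a i x) :
    ∃ u : X (p + 1) (r + 1), (∀ i < a, (S.hor (r + 1)).d p i u = 1) ∧
      (S.hor r).d p a ((S.ver (p + 1)).d r 0 u) = x ∧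
      ∀ i, 1 ≤ i → (S.hor r).d p (a + i) ((S.ver (p + 1)).d r i u) = 1 := by
  induction ham using Nat.decreasingInduction generalizing p r with
  | self =>
    have := hX p r (Or.inr (by omega))
    exact ⟨1, fun i _ => map_one _, Subsingleton.elim _ _, fun i _ => Subsingleton.elim _ _⟩
  | of_succ a ham ih =>
    have ha : ∀ p ≤ a, ∀ q, Subsingleton (X p q) := fun p hp q => hX p q (Or.inl (by omega))
    -- First `x` is lifted along the horizontal `d_a` to a cycle `y` of the décalage.
    obtain ⟨y, hy₁, hy₂, hy₃⟩ : ∃ y : X (p + 1) r, (S.hor r).d p a y = x ∧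
        (∀ i < a, (S.hor r).d p i y = 1) ∧ ∀ i, S.DiagFaceEqOne (a + 1) i y := by
      have hs : ∀ n i (x : X n r), i ≤ n → x ∈ (⊥ : Subgroup (X n r)) →
          (S.hor r).s n i x ∈ (⊥ : Subgroup (X (n + 1) r)) := by
        intro n i x _ h
        rw [Subgroup.mem_bot] at h ⊢
        rw [h, map_one]
      have h₁ : (S.hor r).d p a ((S.hor r).s p a x) = x :=
        (S.hor r).d_s_self _ _ _ (by omega)
      have h₂ : ∀ i < a, (S.hor r).d p i ((S.hor r).s p a x) = 1 := by
        intro i hi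
        obtain ⟨b, rfl⟩ : ∃ b, a = b + 1 := ⟨a - 1, by omega⟩
        exact Subgroup.mem_bot.1 ((S.hor r).d_s_mem' (K := fun _ => ⊥) hs (hx i hi) (by omega)
          (by omega))
      cases r with
      | zero => exact ⟨_, h₁, h₂, fun _ => trivial⟩
      | succ r =>
        obtain ⟨p, rfl⟩ : ∃ p', p = p' + 1 := ⟨p - 1, by omega⟩
        have hx'' : ∀ i, (S.hor r).d p (a + i) ((S.ver (p + 1)).d r i x) = 1 := hx'
        have hk : ∀ i < a + 1, (S.hor r).FaceIn (fun _ => ⊥) i ((S.ver (p + 1)).d r 0 x) := by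
          intro i hi
          change (S.hor r).d p i _ = 1
          rcases Nat.lt_or_ge i a with h | h
          · have := hx i h
            change (S.hor (r + 1)).d p i x = 1 at this
            rw [S.d_d, this, map_one]
          · obtain rfl : i = a := by omega
            exact hx'' 0
        have hk' : ∀ i, S.DiagFaceEqOne (a + 1) i ((S.ver (p + 1)).d r 0 x) := by
          intro i
          cases r with
          | zero => trivial
          | succ r =>
            change (S.hor r).d p (a + 1 + i) _ = 1
            rw [← (S.ver (p + 1)).d_d _ _ _ _ (Nat.zero_le i), S.d_d, add_assoc, add_comm 1 i,
              hx'', map_one]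
        -- The lift `s_a x` has one nontrivial diagonal face, the vertical `d_0 x`. This is a cycle
        -- of Y^{a+1} of degree one less, hence bounds there; dividing by `κ` makes the lift a
        -- cycle.
        obtain ⟨κ, hκ₁, hκ₂, hκ₃⟩ := ih (p + 1) r (by omega) (by omega) _ hk hk'
        refine ⟨(S.hor (r + 1)).s (p + 1) a x * κ⁻¹, ?_, fun i hi => ?_, fun i => ?_⟩
        · rw [map_mul, map_inv, h₁, hκ₁ a (by omega), inv_one, mul_one]
        · rw [map_mul, map_inv, h₂ i hi, hκ₁ i (by omega), inv_one, mul_one]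
        · change (S.hor r).d (p + 1) (a + 1 + i) ((S.ver (p + 2)).d r i _) = 1
          simp only [map_mul, map_inv]
          rw [← S.s_d]
          rcases Nat.eq_zero_or_pos i with rfl | hi
          · rw [add_zero, hκ₂, (S.hor r).d_s_succ _ _ _ (by omega), mul_inv_cancel]
          · rw [hκ₃ i hi, show a + 1 + i = (a + i) + 1 by omega,
              (S.hor r).d_s_of_gt _ _ _ _ (by omega) (by omega), hx'', map_one, inv_one, mul_one]
    obtain ⟨U, hU₁, hU₂, hU₃⟩ := S.exists_contraction ha hp y hy₂ hy₃
    -- The contraction bounds `y` by `U`, and the horizontal `d_a` carries this back to Y^a.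
    refine ⟨(S.hor (r + 1)).d (p + 1) a U, fun i hi => ?_, ?_, fun i hi => ?_⟩
    · obtain ⟨b, rfl⟩ : ∃ b, a = b + 1 := ⟨a - 1, by omega⟩
      rw [(S.hor (r + 1)).d_d _ _ _ _ (by omega), hU₁ i hi, map_one]
    · rw [← S.d_d, ← (S.hor r).d_d _ _ _ _ le_rfl, hU₂, hy₁]
    · rw [← S.d_d, ← (S.hor r).d_d _ _ _ _ (by omega), add_right_comm a i 1, hU₃ i hi, map_one]

/-- If `X p q` is trivial for `p < m` and for `q < n`, then the homotopy groups of the diagonal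
vanish in degrees below `m + n`. -/
theorem exists_diag_boundary (r : ℕ) (hr : r < m + n) (x : X r r)
    (hx : ∀ i, S.DiagFaceEqOne 0 i x) :
    ∃ u : X (r + 1) (r + 1), (S.hor r).d r 0 ((S.ver (r + 1)).d r 0 u) = x ∧
      ∀ i, 1 ≤ i → (S.hor r).d r i ((S.ver (r + 1)).d r i u) = 1 := by
  obtain ⟨u, -, hu, hu'⟩ := S.exists_loop_boundary hX 0 (Nat.zero_le _) r r (by omega) (by omega) x
    (fun i hi => absurd hi (by omega)) hx
  exact ⟨u, hu, fun i hi => by have := hu' i hi; rwa [zero_add] at this⟩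

end BiSimp

open scoped commutatorElement

/-! ## Vanishing of triad homotopy groups -/

namespace NSimp

variable {X : ℕ → Type*} [∀ n, Group (X n)] (S : NSimp X)

/-- A family of subgroups which is closed under the face and degeneracy operators. -/
structure IsSub (K : ∀ n, Subgroup (X n)) : Prop where
  d_mem : ∀ n i x, x ∈ K (n + 1) → S.d n i x ∈ K n
  s_mem : ∀ n i x, x ∈ K n → S.s n i x ∈ K (n + 1)

variable {S}

lemma IsSub.inf {K L : ∀ n, Subgroup (X n)} (hK : S.IsSub K) (hL : S.IsSub L) :
    S.IsSub fun n => K n ⊓ L n :=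
  ⟨fun n i x h => ⟨hK.d_mem n i x h.1, hL.d_mem n i x h.2⟩,
    fun n i x h => ⟨hK.s_mem n i x h.1, hL.s_mem n i x h.2⟩⟩

lemma IsSub.sup {K L : ∀ n, Subgroup (X n)} (hK : S.IsSub K) (hL : S.IsSub L) :
    S.IsSub fun n => K n ⊔ L n := by
  refine ⟨fun n i => ?_, fun n i => ?_⟩
  · change K (n + 1) ⊔ L (n + 1) ≤ (K n ⊔ L n).comap (S.d n i)
    exact sup_le (fun x hx => Subgroup.mem_sup_left (hK.d_mem n i x hx))
      (fun x hx => Subgroup.mem_sup_right (hL.d_mem n i x hx))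
  · change K n ⊔ L n ≤ (K (n + 1) ⊔ L (n + 1)).comap (S.s n i)
    exact sup_le (fun x hx => Subgroup.mem_sup_left (hK.s_mem n i x hx))
      (fun x hx => Subgroup.mem_sup_right (hL.s_mem n i x hx))

lemma isSub_bot : S.IsSub fun _ => ⊥ :=
  ⟨fun n i x h => by rw [Subgroup.mem_bot] at h ⊢; rw [h, map_one],
    fun n i x h => by rw [Subgroup.mem_bot] at h ⊢; rw [h, map_one]⟩

lemma IsSub.faceIn {K : ∀ n, Subgroup (X n)} (hK : S.IsSub K) {n : ℕ} {x : X n} (hx : x ∈ K n)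
    (i : ℕ) : S.FaceIn K i x := by
  cases n with
  | zero => trivial
  | succ n => exact hK.d_mem n i x hx

lemma IsSub.exists_mul_faces_eq_one {K : ∀ n, Subgroup (X n)} (hK : S.IsSub K) {t : ℕ} (ht : 1 ≤ t)
    {n : ℕ} (v : X n) (hv : ∀ i, t ≤ i → S.FaceIn K i v) :
    ∃ κ ∈ K n, ∀ i, t ≤ i → S.FaceIn (fun _ => ⊥) i (v * κ) :=
  S.exists_mul_faces_eq_one hK.d_mem (fun n i x _ h => hK.s_mem n i x h) ht v hv

lemma FaceIn.mul {K : ∀ n, Subgroup (X n)} {n i : ℕ} {x y : X n} (hx : S.FaceIn K i x)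
    (hy : S.FaceIn K i y) : S.FaceIn K i (x * y) := by
  cases n with
  | zero => trivial
  | succ n =>
    change S.d n i (x * y) ∈ K n
    rw [map_mul]
    exact mul_mem hx hy

lemma FaceIn.inv {K : ∀ n, Subgroup (X n)} {n i : ℕ} {x : X n} (hx : S.FaceIn K i x) :
    S.FaceIn K i x⁻¹ := by
  cases n with
  | zero => trivial
  | succ n =>
    change S.d n i x⁻¹ ∈ K n
    rw [map_inv]
    exact inv_mem hx

lemma FaceIn.mono {K L : ∀ n, Subgroup (X n)} (h : ∀ n, K n ≤ L n) {n i : ℕ} {x : X n}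
    (hx : S.FaceIn K i x) : S.FaceIn L i x := by
  cases n with
  | zero => trivial
  | succ n => exact h n hx

lemma FaceIn.inf {K L : ∀ n, Subgroup (X n)} {n i : ℕ} {x : X n} (hx : S.FaceIn K i x)
    (hx' : S.FaceIn L i x) : S.FaceIn (fun n => K n ⊓ L n) i x := by
  cases n with
  | zero => trivial
  | succ n => exact ⟨hx, hx'⟩

lemma d_s_eq_one {n i j : ℕ} {x : X n} (h : S.FaceIn (fun _ => ⊥) i x) (hj : j < i) (hjn : j ≤ n) :
    S.d n (i + 1) (S.s n j x) = 1 :=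
  Subgroup.mem_bot.1 (S.d_s_mem (K := fun _ => ⊥) (fun n i x _ h => isSub_bot.s_mem n i x h)
    h hj hjn)

/-- A decomposition `z = φ * ε` of a simplex with trivial positive faces can be normalized. -/
lemma exists_normalized_decomposition {F E : ∀ n, Subgroup (X n)} (hF : S.IsSub F) (hE : S.IsSub E)
    {n : ℕ} {φ ε : X n} (hφ : φ ∈ F n) (hε : ε ∈ E n)
    (hz : ∀ i, 1 ≤ i → S.FaceIn (fun _ => ⊥) i (φ * ε)) :
    ∃ φ' ∈ F n, ∃ ε' ∈ E n, φ * ε = φ' * ε' ∧ (∀ i, 1 ≤ i → S.FaceIn (fun _ => ⊥) i φ') ∧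
      ∀ i, 1 ≤ i → S.FaceIn (fun _ => ⊥) i ε' := by
  -- The positive faces of `φ` are inverse to those of `ε`, so they lie in both subgroups, and the
  -- correction can be passed from one factor to the other.
  obtain ⟨κ, hκ, h⟩ := (hF.inf hE).exists_mul_faces_eq_one le_rfl φ (fun i hi => by
    refine FaceIn.inf (hF.faceIn hφ i) ?_
    have := ((hz i hi).mono (L := E) fun _ => bot_le).mul (hE.faceIn (inv_mem hε) i)
    rwa [mul_inv_cancel_right] at this)
  refine ⟨φ * κ, mul_mem hφ hκ.1, κ⁻¹ * ε, mul_mem (inv_mem hκ.2) hε, by group, h, fun i hi => ?_⟩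
  have := (h i hi).inv.mul (hz i hi)
  rwa [show (φ * κ)⁻¹ * (φ * ε) = κ⁻¹ * ε by group] at this

variable (S)

/-- Simplicial subgroups `M`, `N` of a simplicial group with a central filtration `W` which is
compatible with them. -/
structure FilteredTriad (M N : ∀ n, Subgroup (X n)) (W : ℕ → ∀ n, Subgroup (X n)) : Prop where
  isSub_left : S.IsSub M
  isSub_right : S.IsSub N
  isSub_W : ∀ w, S.IsSub (W w)
  normal : ∀ w n, (W w n).Normal
  succ_le : ∀ w n, W (w + 1) n ≤ W w n
  central : ∀ w n, ⁅W w n, ⊤⁆ ≤ W (w + 1) n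
  -- This and `right_mem` express that, in the quotient of `W w` by `W (w + 1)`, the images of `M`
  -- and `N` meet only in the image of `M ⊓ N`.
  left_mem : ∀ w n, ∀ ν ∈ N n, ∀ e ∈ W (w + 1) n, ν * e ∈ M n ⊓ W w n →
    ν * e ∈ (M n ⊓ N n ⊓ W w n) ⊔ W (w + 1) n
  right_mem : ∀ w n, ∀ μ ∈ M n, ∀ e ∈ W (w + 1) n, μ * e ∈ N n ⊓ W w n →
    μ * e ∈ (M n ⊓ N n ⊓ W w n) ⊔ W (w + 1) n

/-- The part of `W w` generated by `M`, `N` and `W (w + 1)`. -/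
def decomposables (M N : ∀ n, Subgroup (X n)) (W : ℕ → ∀ n, Subgroup (X n)) (w n : ℕ) :
    Subgroup (X n) :=
  ((M n ⊓ W w n) ⊔ W (w + 1) n) ⊔ ((N n ⊓ W w n) ⊔ W (w + 1) n)

/-- The triad cycles: simplices with zeroth face in `M`, first face in `N` and trivial other
faces. -/
def IsTriadCycle (M N : ∀ n, Subgroup (X n)) {n : ℕ} (x : X (n + 1)) : Prop :=
  S.d n 0 x ∈ M n ∧ S.d n 1 x ∈ N n ∧ ∀ i, 2 ≤ i → S.d n i x = 1

/-- The triad chains: simplices with zeroth face in `M`, first face in `N` and trivial other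
faces, except possibly the second. -/
def IsTriadChain (M N : ∀ n, Subgroup (X n)) {n : ℕ} (x : X (n + 1)) : Prop :=
  S.d n 0 x ∈ M n ∧ S.d n 1 x ∈ N n ∧ ∀ i, 3 ≤ i → S.d n i x = 1

namespace FilteredTriad

variable {S} {M N : ∀ n, Subgroup (X n)} {W : ℕ → ∀ n, Subgroup (X n)}
  (T : S.FilteredTriad M N W)
include T

lemma commute_mk {w n : ℕ} [(W (w + 1) n).Normal] {x : X n} (hx : x ∈ W w n) (y : X n) :
    Commute (x : X n ⧸ W (w + 1) n) (y : X n ⧸ W (w + 1) n) := by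
  rw [← commutatorElement_eq_one_iff_commute]
  change QuotientGroup.mk' _ _ = _
  rw [← MonoidHom.mem_ker, QuotientGroup.ker_mk']
  exact T.central w n (Subgroup.commutator_mem_commutator hx (Subgroup.mem_top y))

/-- Commutators of `K` with the whole group lie in `W (w + 1)`, by centrality of the filtration. -/
lemma normal_of_le {w n : ℕ} {K : Subgroup (X n)} (h : W (w + 1) n ≤ K) (h' : K ≤ W w n) :
    K.Normal := by
  refine ⟨fun x hx g => ?_⟩
  have h₁ : ⁅x, g⁆⁻¹ ∈ K := inv_mem (h (T.central w n
    (Subgroup.commutator_mem_commutator (h' hx) (Subgroup.mem_top g))))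
  have := mul_mem h₁ hx
  rwa [show ⁅x, g⁆⁻¹ * x = g * x * g⁻¹ by rw [commutatorElement_def]; group] at this

lemma isSub_decomposables (w : ℕ) : S.IsSub (decomposables M N W w) :=
  ((T.isSub_left.inf (T.isSub_W w)).sup (T.isSub_W (w + 1))).sup
    ((T.isSub_right.inf (T.isSub_W w)).sup (T.isSub_W (w + 1)))

lemma decomposables_le (w n : ℕ) : decomposables M N W w n ≤ W w n :=
  sup_le (sup_le inf_le_right (T.succ_le w n)) (sup_le inf_le_right (T.succ_le w n))

lemma le_decomposables (w n : ℕ) : W (w + 1) n ≤ decomposables M N W w n :=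
  le_sup_of_le_left le_sup_right

lemma left_le_decomposables (w n : ℕ) : M n ⊓ W w n ≤ decomposables M N W w n :=
  le_sup_of_le_left le_sup_left

lemma right_le_decomposables (w n : ℕ) : N n ⊓ W w n ≤ decomposables M N W w n :=
  le_sup_of_le_right le_sup_left

lemma decomposables_normal (w n : ℕ) : (decomposables M N W w n).Normal :=
  T.normal_of_le (T.le_decomposables w n) (T.decomposables_le w n)

lemma exists_of_mem_decomposables {w n : ℕ} {x : X n} (hx : x ∈ decomposables M N W w n) :
    ∃ a ∈ M n ⊓ W w n, ∃ b ∈ N n ⊓ W w n, ∃ e ∈ W (w + 1) n, x = a * b * e := by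
  have := T.normal (w + 1) n
  have := T.normal_of_le (K := (M n ⊓ W w n) ⊔ W (w + 1) n) le_sup_right
    (sup_le inf_le_right (T.succ_le w n))
  obtain ⟨y, hy, z, hz, rfl⟩ := Subgroup.mem_sup_of_normal_left.1 hx
  obtain ⟨a, ha, e, he, rfl⟩ := Subgroup.mem_sup_of_normal_right.1 hy
  obtain ⟨b, hb, e', he', rfl⟩ := Subgroup.mem_sup_of_normal_right.1 hz
  refine ⟨a, ha, b, hb, b⁻¹ * e * b * e', mul_mem ?_ he', by group⟩
  exact Subgroup.Normal.conj_mem' (T.normal (w + 1) n) e he b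

/-- The first step in the normalization of the decomposition of a triad cycle. -/
lemma exists_decomposition_of_isTriadCycle {w r : ℕ} {y : X (r + 1)}
    (hy : y ∈ decomposables M N W w (r + 1)) (hy' : S.IsTriadCycle M N y) :
    ∃ a ∈ M (r + 1) ⊓ W w (r + 1), ∃ b ∈ N (r + 1) ⊓ W w (r + 1), ∃ e ∈ W (w + 1) (r + 1),
      y = a * b * e ∧ (∀ i, 2 ≤ i → S.d r i a = 1) ∧ ∀ i, 2 ≤ i → S.d r i b = 1 := by
  obtain ⟨a, ha, b, hb, e, he, rfl⟩ := T.exists_of_mem_decomposables hy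
  have hn := T.normal (w + 1) (r + 1)
  have hn' := T.normal (w + 1) r
  have hMW := T.isSub_left.inf (T.isSub_W w)
  have hNW := T.isSub_right.inf (T.isSub_W w)
  have hFW := (T.isSub_left.inf T.isSub_right).inf (T.isSub_W w)
  -- As `d_i y = 1` for `i ≥ 2`, the face `d_i a` is inverse to `d_i b` up to weight `w + 1`. Thus
  -- `left_mem` puts it in `M ⊓ N` up to weight `w + 1`, and it can be cancelled by passing an
  -- element of `M ⊓ N` from `a` to `b`.
  obtain ⟨κ, ⟨hκ, hκ'⟩, h⟩ := (T.isSub_left.inf (hFW.sup (T.isSub_W (w + 1)))).exists_mul_faces_eq_one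
    (t := 2) (by omega) a (fun i hi => by
      refine ⟨T.isSub_left.d_mem _ _ _ ha.1, ?_⟩
      have h := hy'.2.2 i hi
      rw [map_mul, map_mul] at h
      have h' : S.d r i a = (S.d r i b)⁻¹ * (S.d r i b * (S.d r i e)⁻¹ * (S.d r i b)⁻¹) := by
        rw [mul_assoc] at h
        rw [eq_inv_of_mul_eq_one_left h]
        group
      rw [h']
      refine T.left_mem w r _ (inv_mem (T.isSub_right.d_mem _ _ _ hb.1)) _
        (hn'.conj_mem _ (inv_mem ((T.isSub_W _).d_mem _ _ _ he)) _) ?_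
      rw [← h']
      exact hMW.d_mem _ _ _ ha)
  obtain ⟨φ, hφ, e', he', rfl⟩ := Subgroup.mem_sup_of_normal_right.1 hκ'
  set a' := a * (φ * e') with ha'
  set b' := φ⁻¹ * b with hb'
  set e'' := b'⁻¹ * e'⁻¹ * b' * e with he''
  have hb'N : b' ∈ N (r + 1) ⊓ W w (r + 1) := mul_mem (inv_mem ⟨hφ.1.2, hφ.2⟩) hb
  have he''W : e'' ∈ W (w + 1) (r + 1) := mul_mem (hn.conj_mem' _ (inv_mem he') _) he
  have e1 : a * b * e = a' * b' * e'' := by rw [he'', ha', hb']; group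
  have h₀ : ∀ i, 2 ≤ i → S.d r i a' = 1 := fun i hi => h i hi
  -- With these faces of `a'` trivial, those of `b'` have weight `w + 1`, so this correction is
  -- absorbed in the error term.
  obtain ⟨κ', hκ', h'⟩ := (T.isSub_right.inf (T.isSub_W (w + 1))).exists_mul_faces_eq_one
    (t := 2) (by omega) b' (fun i hi => by
      refine ⟨T.isSub_right.d_mem _ _ _ hb'N.1, ?_⟩
      have h₁ := hy'.2.2 i hi
      rw [e1, map_mul, map_mul, h₀ i hi, one_mul] at h₁
      rw [eq_inv_of_mul_eq_one_left h₁]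
      exact Subgroup.inv_mem _ ((T.isSub_W (w + 1)).d_mem _ _ _ he''W))
  refine ⟨a', ⟨mul_mem ha.1 hκ, mul_mem ha.2 (mul_mem hφ.2 (T.succ_le _ _ he'))⟩, b' * κ',
    mul_mem hb'N ⟨hκ'.1, T.succ_le _ _ hκ'.2⟩, κ'⁻¹ * e'', mul_mem (inv_mem hκ'.2) he''W, ?_, h₀,
    h'⟩
  rw [e1]
  group

/-- Up to weight `w + 1`, `d_0 b` lies in `M` because `d_0 y` and `d_0 a` do; likewise `d_1 a` lies
in `N`. The discrepancies `ε₁`, `ε₂` are normalized to have trivial positive faces, so dividing by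
`s_0` of them corrects these faces without spoiling the faces from the second on. -/
lemma exists_good_decomposition_of_isTriadCycle {w r : ℕ} {y : X (r + 1)}
    (hy : y ∈ decomposables M N W w (r + 1)) (hy' : S.IsTriadCycle M N y) :
    ∃ a ∈ M (r + 1) ⊓ W w (r + 1), ∃ b ∈ N (r + 1) ⊓ W w (r + 1), ∃ e ∈ W (w + 1) (r + 1),
      y = a * b * e ∧ (∀ i, 2 ≤ i → S.d r i a = 1) ∧ (∀ i, 2 ≤ i → S.d r i b = 1) ∧
      S.d r 0 b ∈ M r ∧ S.d r 1 a ∈ N r ∧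
      ∀ i, 1 ≤ i → S.FaceIn (fun _ => ⊥) i (S.d r 1 a) := by
  obtain ⟨a, ha, b, hb, e, he, rfl, had, hbd⟩ := T.exists_decomposition_of_isTriadCycle hy hy'
  have hn := T.normal (w + 1) (r + 1)
  have hn' := T.normal (w + 1) r
  have hMW := T.isSub_left.inf (T.isSub_W w)
  have hNW := T.isSub_right.inf (T.isSub_W w)
  have hFW := (T.isSub_left.inf T.isSub_right).inf (T.isSub_W w)
  have hdb : S.d r 0 b ∈ (M r ⊓ N r ⊓ W w r) ⊔ W (w + 1) r := by
    have h := hy'.1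
    rw [map_mul, map_mul] at h
    have h' : S.d r 0 b = ((S.d r 0 a)⁻¹ * (S.d r 0 a * S.d r 0 b * S.d r 0 e)) *
      (S.d r 0 e)⁻¹ := by group
    rw [h']
    refine T.right_mem w r _ (mul_mem (inv_mem (T.isSub_left.d_mem _ _ _ ha.1)) h) _
      (inv_mem ((T.isSub_W _).d_mem _ _ _ he)) ?_
    rw [← h']
    exact hNW.d_mem _ _ _ hb
  have hda : S.d r 1 a ∈ (M r ⊓ N r ⊓ W w r) ⊔ W (w + 1) r := by
    have h := hy'.2.1
    rw [map_mul, map_mul] at h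
    have h' : S.d r 1 a = ((S.d r 1 a * S.d r 1 b * S.d r 1 e) * (S.d r 1 b)⁻¹) *
      (S.d r 1 b * (S.d r 1 e)⁻¹ * (S.d r 1 b)⁻¹) := by group
    rw [h']
    refine T.left_mem w r _ (mul_mem h (inv_mem (T.isSub_right.d_mem _ _ _ hb.1))) _
      (hn'.conj_mem _ (inv_mem ((T.isSub_W _).d_mem _ _ _ he)) _) ?_
    rw [← h']
    exact hMW.d_mem _ _ _ ha
  have hfb : ∀ i, 1 ≤ i → S.FaceIn (fun _ => ⊥) i (S.d r 0 b) := by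
    intro i hi
    cases r with
    | zero => trivial
    | succ r =>
      change S.d r i (S.d (r + 1) 0 b) = 1
      rw [← S.d_d _ _ _ _ (Nat.zero_le i), hbd _ (by omega), map_one]
  have hfa : ∀ i, 1 ≤ i → S.FaceIn (fun _ => ⊥) i (S.d r 1 a) := by
    intro i hi
    cases r with
    | zero => trivial
    | succ r =>
      change S.d r i (S.d (r + 1) 1 a) = 1
      rw [← S.d_d _ _ _ _ hi, had _ (by omega), map_one]
  obtain ⟨φ, hφ, ε, hε, hφε⟩ := Subgroup.mem_sup_of_normal_right.1 hdb
  rw [← hφε] at hfb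
  obtain ⟨φ₁, hφ₁, ε₁, hε₁, h₁, hf₁, hf₁'⟩ := exists_normalized_decomposition hFW
    (T.isSub_right.inf (T.isSub_W (w + 1))) hφ ⟨by
      have hφN : φ ∈ N r := hφ.1.2
      have := mul_mem (inv_mem hφN) (T.isSub_right.d_mem _ 0 _ hb.1)
      rwa [← hφε, inv_mul_cancel_left] at this, hε⟩ hfb
  obtain ⟨ψ, hψ, δ, hδ, hψδ⟩ := Subgroup.mem_sup_of_normal_right.1 hda
  rw [← hψδ] at hfa
  obtain ⟨φ₂, hφ₂, ε₂, hε₂, h₂, hf₂, hf₂'⟩ := exists_normalized_decomposition hFW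
    (T.isSub_left.inf (T.isSub_W (w + 1))) hψ ⟨by
      have hψM : ψ ∈ M r := hψ.1.1
      have := mul_mem (inv_mem hψM) (T.isSub_left.d_mem _ 1 _ ha.1)
      rwa [← hψδ, inv_mul_cancel_left] at this, hδ⟩ hfa
  have hs₁ := (T.isSub_right.inf (T.isSub_W (w + 1))).s_mem _ 0 _ hε₁
  have hs₂ := (T.isSub_left.inf (T.isSub_W (w + 1))).s_mem _ 0 _ hε₂
  set b' := b * (S.s r 0 ε₁)⁻¹ with hb'
  have hda' : S.d r 1 (a * (S.s r 0 ε₂)⁻¹) = φ₂ := by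
    rw [map_mul, map_inv, S.d_s_succ _ _ _ (Nat.zero_le r), ← hψδ, h₂, mul_inv_cancel_right]
  refine ⟨a * (S.s r 0 ε₂)⁻¹, mul_mem ha (inv_mem ⟨hs₂.1, T.succ_le _ _ hs₂.2⟩), b',
    mul_mem hb (inv_mem ⟨hs₁.1, T.succ_le _ _ hs₁.2⟩),
    b'⁻¹ * S.s r 0 ε₂ * b' * (S.s r 0 ε₁ * e), mul_mem (hn.conj_mem' _ hs₂.2 _)
      (mul_mem hs₁.2 he), ?_, fun i hi => ?_, fun i hi => ?_, ?_, ?_, ?_⟩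
  · rw [hb']
    group
  · obtain ⟨i, rfl⟩ : ∃ i', i = i' + 1 := ⟨i - 1, by omega⟩
    rw [map_mul, map_inv, had _ hi, d_s_eq_one (hf₂' i (by omega)) (by omega) (Nat.zero_le r),
      inv_one, mul_one]
  · obtain ⟨i, rfl⟩ : ∃ i', i = i' + 1 := ⟨i - 1, by omega⟩
    rw [map_mul, map_inv, hbd _ hi, d_s_eq_one (hf₁' i (by omega)) (by omega) (Nat.zero_le r),
      inv_one, mul_one]
  · rw [map_mul, map_inv, S.d_s_self _ _ _ (Nat.zero_le r), ← hφε, h₁, mul_inv_cancel_right]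
    exact hφ₁.1.1
  · rw [hda']
    exact hφ₂.1.2
  · rw [hda']
    exact hf₂

lemma exists_isTriadChain_of_mem_decomposables {w r : ℕ} {y : X (r + 1)}
    (hy : y ∈ decomposables M N W w (r + 1)) (hy' : S.IsTriadCycle M N y) :
    ∃ u : X (r + 2), S.IsTriadChain M N u ∧ (S.d (r + 1) 2 u)⁻¹ * y ∈ W (w + 1) (r + 1) := by
  obtain ⟨a, ha, b, hb, e, he, rfl, had, hbd, hb₀, ha₁, hf⟩ :=
    T.exists_good_decomposition_of_isTriadCycle hy hy'
  have hn := T.normal (w + 1) (r + 1)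
  set φ := S.d r 1 a with hφ
  have hφM : φ ∈ M r := T.isSub_left.d_mem _ _ _ ha.1
  have hφW : φ ∈ W w r := (T.isSub_W w).d_mem _ _ _ ha.2
  have r₁ : 1 ≤ r + 1 := by omega
  -- On the first face the two degeneracies of `a` cancel, leaving `b * s_0 φ` in `N`. On the second
  -- face `s_0 a` contributes the inverse of `s_0 φ`, which the last factor cancels because `b` is
  -- central modulo `W (w + 1)`; there remains `a * b`.
  refine ⟨S.s (r + 1) 1 a * (S.s (r + 1) 0 a)⁻¹ * S.s (r + 1) 1 b * S.s (r + 1) 1 (S.s r 0 φ),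
    ⟨?_, ?_, fun i hi => ?_⟩, ?_⟩
  · rw [map_mul, map_mul, map_mul, map_inv, S.d_s_of_le _ _ _ _ le_rfl (Nat.zero_le r),
      S.d_s_self _ _ _ (Nat.zero_le _), S.d_s_of_le _ _ _ _ le_rfl (Nat.zero_le r),
      S.d_s_of_le _ _ _ _ le_rfl (Nat.zero_le r), S.d_s_self _ _ _ (Nat.zero_le _)]
    exact mul_mem (mul_mem (mul_mem (T.isSub_left.s_mem _ _ _ (T.isSub_left.d_mem _ _ _ ha.1))
      (inv_mem ha.1)) (T.isSub_left.s_mem _ _ _ hb₀)) (T.isSub_left.s_mem _ _ _ hφM)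
  · rw [map_mul, map_mul, map_mul, map_inv, S.d_s_self _ _ _ r₁, S.d_s_succ _ _ _ (Nat.zero_le _),
      S.d_s_self _ _ _ r₁, S.d_s_self _ _ _ r₁, mul_inv_cancel, one_mul]
    exact mul_mem hb.1 (T.isSub_right.s_mem _ _ _ ha₁)
  · obtain ⟨i, rfl⟩ : ∃ i', i = i' + 2 := ⟨i - 2, by omega⟩
    have h : S.d r (i + 1) (S.s r 0 φ) = 1 := d_s_eq_one (hf i (by omega)) (by omega)
      (Nat.zero_le r)
    have ha' : S.FaceIn (fun _ => ⊥) (i + 1) a := had (i + 1) (by omega)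
    have hb' : S.FaceIn (fun _ => ⊥) (i + 1) b := hbd (i + 1) (by omega)
    have h' : S.FaceIn (fun _ => ⊥) (i + 1) (S.s r 0 φ) := h
    rw [map_mul, map_mul, map_mul, map_inv, d_s_eq_one ha' (by omega) r₁,
      d_s_eq_one ha' (by omega) (Nat.zero_le _), d_s_eq_one hb' (by omega) r₁,
      d_s_eq_one h' (by omega) r₁]
    simp
  · rw [← QuotientGroup.eq, map_mul, map_mul, map_mul, map_inv, S.d_s_succ _ _ _ r₁,
      S.d_s_of_gt _ _ _ _ Nat.zero_lt_one (Nat.zero_le r), S.d_s_succ _ _ _ r₁,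
      S.d_s_succ _ _ _ r₁]
    simp only [QuotientGroup.mk_mul, QuotientGroup.mk_inv]
    rw [(QuotientGroup.eq_one_iff e).2 he, mul_one, mul_assoc, (T.commute_mk hb.2 _).eq, ← hφ]
    group

variable {L : ℕ} (hL : ∀ w r, r < L → ∀ x ∈ W w r, (∀ i, S.FaceIn (decomposables M N W w) i x) →
  ∃ v : X (r + 1), (S.d r 0 v)⁻¹ * x ∈ decomposables M N W w r ∧
    ∀ i, 1 ≤ i → S.d r i v ∈ decomposables M N W w r)
include hL

/-- The hypothesis `hL` is acyclicity of the graded pieces below degree `L`. It solves the problem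
modulo decomposables, and the previous lemma handles what is left. -/
lemma exists_isTriadChain_of_mem {w r : ℕ} (hr : r + 1 < L) {x : X (r + 1)}
    (hx : x ∈ W w (r + 1)) (hx' : S.IsTriadCycle M N x) :
    ∃ u : X (r + 2), S.IsTriadChain M N u ∧ (S.d (r + 1) 2 u)⁻¹ * x ∈ W (w + 1) (r + 1) := by
  set D := decomposables M N W w with hD
  have hDs : S.IsSub D := T.isSub_decomposables w
  have hDn : ∀ n, (D n).Normal := T.decomposables_normal w
  have hxD : ∀ i, S.d r i x ∈ D r := by
    intro i
    have hi := (T.isSub_W w).d_mem _ i _ hx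
    rcases (show i = 0 ∨ i = 1 ∨ 2 ≤ i by omega) with rfl | rfl | h
    · exact T.left_le_decomposables w r ⟨hx'.1, hi⟩
    · exact T.right_le_decomposables w r ⟨hx'.2.1, hi⟩
    · rw [hx'.2.2 i h]
      exact one_mem _
  have hxq : ∀ i j, ((S.s r j (S.d r i x) : X (r + 1)) : X (r + 1) ⧸ D (r + 1)) = 1 := fun i j =>
    (QuotientGroup.eq_one_iff _).2 (hDs.s_mem _ _ _ (hxD i))
  have r₁ : 1 ≤ r + 1 := by omega
  -- Acyclicity presents `x` as a zeroth face; two degeneracies of `x` move it to the second face.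
  obtain ⟨v₁, h₁, h₁'⟩ : ∃ v : X (r + 2), (S.d (r + 1) 2 v : X (r + 1) ⧸ D (r + 1)) = x ∧
      ∀ i, i ≠ 2 → S.d (r + 1) i v ∈ D (r + 1) := by
    obtain ⟨v, hv, hv'⟩ := hL w (r + 1) hr x hx hxD
    have hv : ((S.d (r + 1) 0 v : X (r + 1)) : X (r + 1) ⧸ D (r + 1)) = x := QuotientGroup.eq.2 hv
    have hvq : ∀ i, 1 ≤ i → ((S.d (r + 1) i v : X (r + 1)) : X (r + 1) ⧸ D (r + 1)) = 1 :=
      fun i hi => (QuotientGroup.eq_one_iff _).2 (hv' i hi)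
    refine ⟨v * (S.s (r + 1) 0 x)⁻¹ * S.s (r + 1) 1 x, ?_, fun i hi => ?_⟩
    · rw [map_mul, map_mul, map_inv, S.d_s_succ _ _ _ r₁,
        S.d_s_of_gt _ _ _ _ Nat.zero_lt_one (Nat.zero_le r)]
      simp [hvq, hxq]
    · rw [← QuotientGroup.eq_one_iff, map_mul, map_mul, map_inv]
      rcases (show i = 0 ∨ i = 1 ∨ 3 ≤ i by omega) with rfl | rfl | h
      · rw [S.d_s_self _ _ _ (Nat.zero_le _), S.d_s_of_le _ _ _ _ le_rfl (Nat.zero_le r)]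
        simp [hv, hxq]
      · rw [S.d_s_succ _ _ _ (Nat.zero_le _), S.d_s_self _ _ _ r₁]
        simp [hvq]
      · obtain ⟨i, rfl⟩ : ∃ i', i = i' + 1 := ⟨i - 1, by omega⟩
        have h' : S.FaceIn (fun _ => ⊥) i x := hx'.2.2 i (by omega)
        rw [d_s_eq_one h' (by omega) (Nat.zero_le _), d_s_eq_one h' (by omega) r₁]
        simp [hvq]
  -- The faces other than the second, so far trivial only modulo `D`, are now made exactly trivial:
  -- those from the third on here, then the zeroth and the first.
  obtain ⟨v₂, h₂, h₂', h₂''⟩ : ∃ v : X (r + 2), (S.d (r + 1) 2 v : X (r + 1) ⧸ D (r + 1)) = x ∧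
      (∀ i, i ≠ 2 → S.d (r + 1) i v ∈ D (r + 1)) ∧ ∀ i, 3 ≤ i → S.d (r + 1) i v = 1 := by
    obtain ⟨κ, hκ, h⟩ := hDs.exists_mul_faces_eq_one (t := 3) (by omega) v₁
      (fun i hi => h₁' i (by omega))
    refine ⟨v₁ * κ, ?_, fun i hi => ?_, h⟩
    · rw [map_mul, QuotientGroup.mk_mul, h₁,
        (QuotientGroup.eq_one_iff (S.d (r + 1) 2 κ)).2 (hDs.d_mem _ _ _ hκ), mul_one]
    · rw [map_mul]
      exact mul_mem (h₁' i hi) (hDs.d_mem _ _ _ hκ)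
  obtain ⟨v₃, h₃, h₃₀, h₃₁, h₃'⟩ : ∃ v : X (r + 2),
      (S.d (r + 1) 2 v : X (r + 1) ⧸ D (r + 1)) = x ∧ S.d (r + 1) 0 v = 1 ∧
      S.d (r + 1) 1 v ∈ D (r + 1) ∧ ∀ i, 3 ≤ i → S.d (r + 1) i v = 1 := by
    -- The change in the second face is `s_0 d_0 d_2 v₂`, which is in `D` because `d_2 v₂` is
    -- congruent to `x` and `d_0 x` is in `D`.
    refine ⟨v₂ * (S.s (r + 1) 0 (S.d (r + 1) 0 v₂))⁻¹, ?_, ?_, ?_, fun i hi => ?_⟩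
    · rw [map_mul, map_inv, S.d_s_of_gt _ _ _ _ Nat.zero_lt_one (Nat.zero_le r),
        ← S.d_d _ _ _ _ (Nat.zero_le 1), QuotientGroup.mk_mul, h₂, QuotientGroup.mk_inv,
        (QuotientGroup.eq_one_iff (S.s r 0 _)).2, inv_one, mul_one]
      refine hDs.s_mem _ _ _ ?_
      have := mul_mem (hxD 0) (hDs.d_mem _ 0 _ (QuotientGroup.eq.1 h₂.symm))
      rwa [← map_mul, mul_inv_cancel_left] at this
    · rw [map_mul, map_inv, S.d_s_self _ _ _ (Nat.zero_le _), mul_inv_cancel]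
    · rw [map_mul, map_inv, S.d_s_succ _ _ _ (Nat.zero_le _)]
      exact mul_mem (h₂' 1 (by omega)) (inv_mem (h₂' 0 (by omega)))
    · obtain ⟨i, rfl⟩ : ∃ i', i = i' + 1 := ⟨i - 1, by omega⟩
      rw [map_mul, map_inv, h₂'' _ hi, d_s_eq_one _ (by omega) (Nat.zero_le _), inv_one, mul_one]
      change S.d r i _ = 1
      rw [← S.d_d _ _ _ _ (Nat.zero_le i), h₂'' _ hi, map_one]
  obtain ⟨v, h₄, h₄₀, h₄₁, h₄'⟩ : ∃ v : X (r + 2),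
      (S.d (r + 1) 2 v : X (r + 1) ⧸ D (r + 1)) = x ∧ S.d (r + 1) 0 v = 1 ∧
      S.d (r + 1) 1 v = 1 ∧ ∀ i, 3 ≤ i → S.d (r + 1) i v = 1 := by
    refine ⟨v₃ * (S.s (r + 1) 1 (S.d (r + 1) 1 v₃))⁻¹, ?_, ?_, ?_, fun i hi => ?_⟩
    · rw [map_mul, map_inv, S.d_s_succ _ _ _ r₁, QuotientGroup.mk_mul, h₃, QuotientGroup.mk_inv,
        (QuotientGroup.eq_one_iff (S.d (r + 1) 1 v₃)).2 h₃₁, inv_one, mul_one]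
    · rw [map_mul, map_inv, S.d_s_of_le _ _ _ _ le_rfl (Nat.zero_le r), h₃₀, one_mul,
        S.d_d _ _ _ _ le_rfl, h₃₀, map_one, map_one, inv_one]
    · rw [map_mul, map_inv, S.d_s_self _ _ _ r₁, mul_inv_cancel]
    · obtain ⟨i, rfl⟩ : ∃ i', i = i' + 1 := ⟨i - 1, by omega⟩
      rw [map_mul, map_inv, h₃' _ hi, d_s_eq_one _ (by omega) r₁, inv_one, mul_one]
      change S.d r i _ = 1
      rw [← S.d_d _ _ _ _ (by omega), h₃' _ hi, map_one]
  have hy : (S.d (r + 1) 2 v)⁻¹ * x ∈ D (r + 1) := QuotientGroup.eq.1 h₄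
  -- Because its other faces are exactly trivial, dividing `x` by the second face of `v` leaves a
  -- triad cycle.
  obtain ⟨u, ⟨hu₀, hu₁, hu₃⟩, hu⟩ := T.exists_isTriadChain_of_mem_decomposables hy (by
    refine ⟨?_, ?_, fun i hi => ?_⟩
    · rw [map_mul, map_inv, S.d_d _ _ _ _ (Nat.zero_le 1), h₄₀, map_one, inv_one, one_mul]
      exact hx'.1
    · rw [map_mul, map_inv, S.d_d _ _ _ _ le_rfl, h₄₁, map_one, inv_one, one_mul]
      exact hx'.2.1
    · rw [map_mul, map_inv, ← S.d_d _ _ _ _ hi, h₄' _ (by omega), map_one, inv_one, one_mul]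
      exact hx'.2.2 i hi)
  refine ⟨v * u, ⟨?_, ?_, fun i hi => ?_⟩, ?_⟩
  · rw [map_mul, h₄₀, one_mul]
    exact hu₀
  · rw [map_mul, h₄₁, one_mul]
    exact hu₁
  · rw [map_mul, h₄' i hi, hu₃ i hi, one_mul]
  · rwa [map_mul, mul_inv_rev, mul_assoc]

/-- The vanishing of triad homotopy groups. -/
theorem exists_isTriadChain {K : ℕ} (h₁ : ∀ n, W 1 n = ⊤) (hK : ∀ n, W (K + 1) n = ⊥) {r : ℕ}
    (hr : r + 1 < L) {x : X (r + 1)} (hx' : S.IsTriadCycle M N x) :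
    ∃ u : X (r + 2), S.IsTriadChain M N u ∧ S.d (r + 1) 2 u = x := by
  -- Successive approximation: the remainder is again a triad cycle, of higher weight at each step.
  have key : ∀ w ≤ K, ∃ u : X (r + 2), S.IsTriadChain M N u ∧
      (S.d (r + 1) 2 u)⁻¹ * x ∈ W (w + 1) (r + 1) := by
    intro w hw
    induction w with
    | zero =>
      refine ⟨1, ⟨?_, ?_, fun i _ => map_one _⟩, by rw [h₁]; trivial⟩ <;>
      · rw [map_one]
        exact one_mem _
    | succ w ih =>
      obtain ⟨u, ⟨hu₀, hu₁, hu₃⟩, hu⟩ := ih (by omega)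
      obtain ⟨v, ⟨hv₀, hv₁, hv₃⟩, hv⟩ := T.exists_isTriadChain_of_mem hL hr hu (by
        refine ⟨?_, ?_, fun i hi => ?_⟩
        · rw [map_mul, map_inv, S.d_d _ _ _ _ (Nat.zero_le 1)]
          exact mul_mem (inv_mem (T.isSub_left.d_mem _ _ _ hu₀)) hx'.1
        · rw [map_mul, map_inv, S.d_d _ _ _ _ le_rfl]
          exact mul_mem (inv_mem (T.isSub_right.d_mem _ _ _ hu₁)) hx'.2.1
        · rw [map_mul, map_inv, ← S.d_d _ _ _ _ hi, hu₃ _ (by omega), map_one, inv_one, one_mul]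
          exact hx'.2.2 i hi)
      refine ⟨u * v, ⟨?_, ?_, fun i hi => ?_⟩, ?_⟩
      · rw [map_mul]
        exact mul_mem hu₀ hv₀
      · rw [map_mul]
        exact mul_mem hu₁ hv₁
      · rw [map_mul, hu₃ i hi, hv₃ i hi, one_mul]
      · rwa [map_mul, mul_inv_rev, mul_assoc]
  obtain ⟨u, hu, h⟩ := key K le_rfl
  rw [hK, Subgroup.mem_bot, inv_mul_eq_one] at h
  exact ⟨u, hu, h⟩

end FilteredTriad

end NSimp

/-! ## Constructions of simplicial and bisimplicial operators -/

namespace NSimp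

section OfMaps

variable {X : ℕ → Type*} [∀ n, Group (X n)] (map : ∀ {p q : ℕ}, (⦋q⦌ ⟶ ⦋p⦌) → X p →* X q)
  (map_id : ∀ p x, map (𝟙 ⦋p⦌) x = x)
  (map_map : ∀ {p q r : ℕ} (α : ⦋q⦌ ⟶ ⦋p⦌) (β : ⦋r⦌ ⟶ ⦋q⦌) (x : X p),
    map β (map α x) = map (β ≫ α) x)

/-- The operators of a simplicial group which is given as a contravariant functor. -/
def ofMaps : NSimp X where
  d n i := if h : i < n + 2 then map (SimplexCategory.δ ⟨i, h⟩) else 1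
  s n i := if h : i < n + 1 then map (SimplexCategory.σ ⟨i, h⟩) else 1
  d_of_lt n i x h := by rw [dif_neg (by omega)]; rfl
  d_d n i j x hij := by
    by_cases hj : j < n + 2
    · rw [dif_pos (by omega), dif_pos (by omega), dif_pos (by omega), dif_pos (by omega), map_map,
        map_map]
      have := SimplexCategory.δ_comp_δ (n := n) (i := ⟨i, by omega⟩) (j := ⟨j, by omega⟩) hij
      rw [Fin.succ_mk, Fin.castSucc_mk] at this
      rw [this]
    · rw [dif_neg (c := j + 1 < n + 1 + 2) (by omega), dif_neg (c := j < n + 2) (by omega)]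
      exact map_one _
  d_s_of_le n i j x hij hj := by
    rw [dif_pos (by omega), dif_pos (by omega), dif_pos (by omega), dif_pos (by omega), map_map,
      map_map]
    have := SimplexCategory.δ_comp_σ_of_le (n := n) (i := ⟨i, by omega⟩) (j := ⟨j, by omega⟩) hij
    rw [Fin.succ_mk, Fin.castSucc_mk] at this
    rw [this]
  d_s_self n j x hj := by
    rw [dif_pos (by omega), dif_pos (by omega), map_map]
    have := SimplexCategory.δ_comp_σ_self (n := n) (i := ⟨j, by omega⟩)
    rw [Fin.castSucc_mk] at this
    rw [this, map_id]
  d_s_succ n j x hj := by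
    rw [dif_pos (by omega), dif_pos (by omega), map_map]
    have := SimplexCategory.δ_comp_σ_succ (n := n) (i := ⟨j, by omega⟩)
    rw [Fin.succ_mk] at this
    rw [this, map_id]
  d_s_of_gt n i j x hij hj := by
    by_cases hi : i < n + 2
    · rw [dif_pos (by omega), dif_pos (by omega), dif_pos (by omega), dif_pos (by omega), map_map,
        map_map]
      have := SimplexCategory.δ_comp_σ_of_gt (n := n) (i := ⟨i, by omega⟩) (j := ⟨j, by omega⟩) hij
      rw [Fin.succ_mk, Fin.castSucc_mk] at this
      rw [this]
    · rw [dif_neg (c := i + 1 < n + 1 + 2) (by omega), dif_neg (c := i < n + 2) (by omega)]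
      exact (map_one _).symm

lemma ofMaps_d {n i : ℕ} (h : i < n + 2) (x : X (n + 1)) :
    (ofMaps map map_id map_map).d n i x = map (SimplexCategory.δ ⟨i, h⟩) x := by
  change (dite _ _ _ : X (n + 1) →* X n) x = _
  rw [dif_pos h]

lemma ofMaps_s {n i : ℕ} (h : i < n + 1) (x : X n) :
    (ofMaps map map_id map_map).s n i x = map (SimplexCategory.σ ⟨i, h⟩) x := by
  change (dite _ _ _ : X n →* X (n + 1)) x = _
  rw [dif_pos h]

lemma ofMaps_s_of_le {n i : ℕ} (h : n + 1 ≤ i) (x : X n) :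
    (ofMaps map map_id map_map).s n i x = 1 := by
  change (dite _ _ _ : X n →* X (n + 1)) x = _
  rw [dif_neg (by omega)]
  rfl

lemma isSub_ofMaps {K : ∀ n, Subgroup (X n)}
    (hK : ∀ {p q : ℕ} (α : ⦋q⦌ ⟶ ⦋p⦌), ∀ x ∈ K p, map α x ∈ K q) :
    (ofMaps map map_id map_map).IsSub K := by
  refine ⟨fun n i x hx => ?_, fun n i x hx => ?_⟩
  · rcases Nat.lt_or_ge i (n + 2) with h | h
    · rw [ofMaps_d map map_id map_map h]
      exact hK _ _ hx
    · rw [(ofMaps map map_id map_map).d_of_lt _ _ _ (by omega)]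
      exact one_mem _
  · rcases Nat.lt_or_ge i (n + 1) with h | h
    · rw [ofMaps_s map map_id map_map h]
      exact hK _ _ hx
    · rw [ofMaps_s_of_le map map_id map_map h]
      exact one_mem _

end OfMaps

end NSimp

namespace BiSimp

section OfMaps

variable {X : ℕ → ℕ → Type*} [∀ p q, CommGroup (X p q)]
  (map : ∀ {p q p' q' : ℕ}, (⦋p'⦌ ⟶ ⦋p⦌) → (⦋q'⦌ ⟶ ⦋q⦌) → X p q →* X p' q')
  (map_id : ∀ p q x, map (𝟙 ⦋p⦌) (𝟙 ⦋q⦌) x = x)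
  (map_map : ∀ {p q p' q' p'' q'' : ℕ} (α : ⦋p'⦌ ⟶ ⦋p⦌) (β : ⦋q'⦌ ⟶ ⦋q⦌) (α' : ⦋p''⦌ ⟶ ⦋p'⦌)
    (β' : ⦋q''⦌ ⟶ ⦋q'⦌) (x : X p q), map α' β' (map α β x) = map (α' ≫ α) (β' ≫ β) x)

/-- The operators of a bisimplicial abelian group which is given as a contravariant bifunctor. -/
def ofMaps : BiSimp X where
  hor q := NSimp.ofMaps (X := fun p => X p q) (fun α => map α (𝟙 ⦋q⦌)) (fun p => map_id p q)
    (fun α β x => by rw [map_map, Category.comp_id])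
  ver p := NSimp.ofMaps (X := fun q => X p q) (fun β => map (𝟙 ⦋p⦌) β) (fun q => map_id p q)
    (fun α β x => by rw [map_map, Category.comp_id])
  d_d p q i j x := by
    change (dite _ _ _ : X (p + 1) q →* X p q) ((dite _ _ _ : X (p + 1) (q + 1) →* X (p + 1) q) x) =
      (dite _ _ _ : X p (q + 1) →* X p q) ((dite _ _ _ : X (p + 1) (q + 1) →* X p (q + 1)) x)
    split_ifs
    · rw [map_map, map_map, Category.comp_id, Category.id_comp, Category.comp_id, Category.id_comp]
    · exact map_one _
    · exact (map_one _).symm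
    · rfl
  d_s p q i j x := by
    change (dite _ _ _ : X (p + 1) (q + 1) →* X p (q + 1))
        ((dite _ _ _ : X (p + 1) q →* X (p + 1) (q + 1)) x) =
      (dite _ _ _ : X p q →* X p (q + 1)) ((dite _ _ _ : X (p + 1) q →* X p q) x)
    split_ifs
    · rw [map_map, map_map, Category.comp_id, Category.id_comp, Category.comp_id, Category.id_comp]
    · exact map_one _
    · exact (map_one _).symm
    · rfl
  s_d p q i j x := by
    change (dite _ _ _ : X p q →* X (p + 1) q)
        ((dite _ _ _ : X p (q + 1) →* X p q) x) =
      (dite _ _ _ : X (p + 1) (q + 1) →* X (p + 1) q)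
        ((dite _ _ _ : X p (q + 1) →* X (p + 1) (q + 1)) x)
    split_ifs
    · rw [map_map, map_map, Category.comp_id, Category.id_comp, Category.comp_id, Category.id_comp]
    · exact map_one _
    · exact (map_one _).symm
    · rfl

lemma ofMaps_d_d {p q i : ℕ} (hp : i < p + 2) (hq : i < q + 2) (x : X (p + 1) (q + 1)) :
    ((ofMaps map map_id map_map).hor q).d p i (((ofMaps map map_id map_map).ver (p + 1)).d q i x) =
      map (SimplexCategory.δ ⟨i, hp⟩) (SimplexCategory.δ ⟨i, hq⟩) x := by
  change (dite _ _ _ : X (p + 1) q →* X p q) ((dite _ _ _ : X (p + 1) (q + 1) →* X (p + 1) q) x) = _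
  rw [dif_pos hp, dif_pos hq, map_map, Category.comp_id, Category.id_comp]

lemma diagFaceEqOne_ofMaps {r : ℕ} {x : X (r + 1) (r + 1)}
    (hx : ∀ i : Fin (r + 2), map (SimplexCategory.δ i) (SimplexCategory.δ i) x = 1) (i : ℕ) :
    (ofMaps map map_id map_map).DiagFaceEqOne 0 i x := by
  change ((ofMaps map map_id map_map).hor r).d r (0 + i) _ = 1
  rw [zero_add]
  rcases Nat.lt_or_ge i (r + 2) with h | h
  · rw [ofMaps_d_d map map_id map_map h h]
    exact hx ⟨i, h⟩
  · exact ((ofMaps map map_id map_map).hor r).d_of_lt _ _ _ (by omega)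

end OfMaps

end BiSimp

/-! ## The graded pieces of the weighted series of a triad -/

namespace WeightedSeries

open Subgroup
open scoped commutatorElement

variable {G H K : Type*} [Group G] [Group H] [Group K]

/-- The part of the `w`-th term of the weighted series which comes from the subgroups `M`, `N`
and from the next term. -/
def decomposables (M N : Subgroup G) (w : ℕ) : Subgroup G :=
  ((M ⊓ W N w) ⊔ W N (w + 1)) ⊔ ((N ⊓ W N w) ⊔ W N (w + 1))

lemma le_decomposables (M N : Subgroup G) (w : ℕ) : W N (w + 1) ≤ decomposables M N w :=
  le_sup_of_le_left le_sup_right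

lemma W_le_decomposables {M N : Subgroup G} (h : M = ⊤ ∨ N = ⊤) (w : ℕ) :
    W N w ≤ decomposables M N w := by
  rcases h with rfl | rfl
  · exact le_sup_of_le_left (le_sup_of_le_left (le_inf le_top le_rfl))
  · exact le_sup_of_le_right (le_sup_of_le_left (le_inf le_top le_rfl))

lemma map_mem_decomposables {M N : Subgroup G} {M' N' : Subgroup H} (f : G →* H)
    (hM : ∀ x ∈ M, f x ∈ M') (hN : ∀ x ∈ N, f x ∈ N') {w : ℕ} {x : G}
    (hx : x ∈ decomposables M N w) : f x ∈ decomposables M' N' w := by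
  have hW : ∀ w, W N w ≤ (W N' w).comap f := W_le_comap f hN
  have key : decomposables M N w ≤ (decomposables M' N' w).comap f :=
    sup_le
      (sup_le (fun x hx => mem_sup_left (mem_sup_left ⟨hM x hx.1, hW w hx.2⟩))
        (fun x hx => mem_sup_left (mem_sup_right (hW (w + 1) hx))))
      (sup_le (fun x hx => mem_sup_right (mem_sup_left ⟨hN x hx.1, hW w hx.2⟩))
        (fun x hx => mem_sup_right (mem_sup_right (hW (w + 1) hx))))
  exact key hx

instance decomposables_subgroupOf_normal (M N : Subgroup G) (w : ℕ) :
    ((decomposables M N w).subgroupOf (W N w)).Normal := by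
  refine ⟨fun x hx g => ?_⟩
  have h : ⁅(x : G), (g : G)⁆⁻¹ ∈ decomposables M N w :=
    inv_mem (le_decomposables M N w (commutator_W_top_le w
      (commutator_mem_commutator x.2 (mem_top (g : G)))))
  have := mul_mem h (mem_subgroupOf.1 hx)
  rw [mem_subgroupOf]
  convert this using 1
  simp [commutatorElement_def, mul_assoc]

/-- The `w`-th graded piece of the weighted series modulo decomposable elements. -/
abbrev GradedPiece (M N : Subgroup G) (w : ℕ) := W N w ⧸ (decomposables M N w).subgroupOf (W N w)

instance (M N : Subgroup G) (w : ℕ) : CommGroup (GradedPiece M N w) where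
  mul_comm x y := by
    obtain ⟨x, rfl⟩ := QuotientGroup.mk_surjective x
    obtain ⟨y, rfl⟩ := QuotientGroup.mk_surjective y
    rw [← QuotientGroup.mk_mul, ← QuotientGroup.mk_mul, QuotientGroup.eq, mem_subgroupOf]
    have h := le_decomposables M N w (commutator_W_top_le w
      (commutator_mem_commutator (inv_mem y.2) (mem_top ((x : G)⁻¹))))
    convert h using 1
    simp [commutatorElement_def, mul_assoc]

/-- The map of graded pieces induced by a homomorphism. -/
def GradedPiece.map {M N : Subgroup G} {M' N' : Subgroup H} (w : ℕ) (f : G →* H)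
    (hM : ∀ x ∈ M, f x ∈ M') (hN : ∀ x ∈ N, f x ∈ N') :
    GradedPiece M N w →* GradedPiece M' N' w :=
  QuotientGroup.map _ _ ((f.comp (W N w).subtype).codRestrict (W N' w)
    fun x => map_mem_W f hN x.2) fun x hx => by
      rw [mem_comap, mem_subgroupOf]
      exact map_mem_decomposables f hM hN (mem_subgroupOf.1 hx)

lemma GradedPiece.map_mk {M N : Subgroup G} {M' N' : Subgroup H} (w : ℕ) (f : G →* H)
    (hM : ∀ x ∈ M, f x ∈ M') (hN : ∀ x ∈ N, f x ∈ N') (x : G) (hx : x ∈ W N w) :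
    GradedPiece.map w f hM hN (QuotientGroup.mk ⟨x, hx⟩) =
      QuotientGroup.mk ⟨f x, map_mem_W f hN hx⟩ := rfl

lemma GradedPiece.mk_eq_one {M N : Subgroup G} {w : ℕ} {x : G} {hx : x ∈ W N w} :
    (QuotientGroup.mk ⟨x, hx⟩ : GradedPiece M N w) = 1 ↔ x ∈ decomposables M N w := by
  rw [QuotientGroup.eq_one_iff, mem_subgroupOf]

lemma GradedPiece.mk_eq_mk {M N : Subgroup G} {w : ℕ} {x y : G} {hx : x ∈ W N w} {hy : y ∈ W N w} :
    (QuotientGroup.mk ⟨x, hx⟩ : GradedPiece M N w) = QuotientGroup.mk ⟨y, hy⟩ ↔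
      x⁻¹ * y ∈ decomposables M N w := by
  rw [QuotientGroup.eq, mem_subgroupOf]
  rfl

lemma GradedPiece.subsingleton {M N : Subgroup G} (h : M = ⊤ ∨ N = ⊤) (w : ℕ) :
    Subsingleton (GradedPiece M N w) := by
  have h' : (decomposables M N w).subgroupOf (W N w) = ⊤ :=
    subgroupOf_eq_top.2 (W_le_decomposables h w)
  rw [GradedPiece, h']
  exact QuotientGroup.subsingleton_quotient_top

end WeightedSeries

/-! ## Coproducts of nilpotent groups -/

namespace NilCoprod

open Subgroup

variable (k : ℕ) {A B A' B' H : Type*} [Group A] [Group B] [Group A'] [Group B'] [Group H]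
  (R : Set A)

/-- The relations defining the coproduct of `A / R` and `B` in nilpotent groups. -/
def relations (B : Type*) [Group B] : Subgroup (Monoid.Coprod A B) :=
  normalClosure (Monoid.Coprod.inl '' R) ⊔ (⊤ : Subgroup (Monoid.Coprod A B)).lowerCentralSeries k

instance : (relations k R B).Normal := by
  unfold relations
  infer_instance

end NilCoprod

/-- The coproduct of the quotient of `A` by `R` and of `B` in the category of `nil(k)`-groups. -/
abbrev NilCoprod (k : ℕ) {A : Type*} [Group A] (R : Set A) (B : Type*) [Group B] :=
  Monoid.Coprod A B ⧸ NilCoprod.relations k R B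

namespace NilCoprod

open Subgroup

variable {k : ℕ} {A B A' B' H : Type*} [Group A] [Group B] [Group A'] [Group B'] [Group H]
  {R : Set A} {R' : Set A'}

/-- The map from the first summand. -/
def inl (k : ℕ) (R : Set A) (B : Type*) [Group B] : A →* NilCoprod k R B :=
  (QuotientGroup.mk' _).comp Monoid.Coprod.inl

/-- The map from the second summand. -/
def inr (k : ℕ) (R : Set A) (B : Type*) [Group B] : B →* NilCoprod k R B :=
  (QuotientGroup.mk' _).comp Monoid.Coprod.inr

lemma inl_eq_one {a : A} (ha : a ∈ R) : inl k R B a = 1 :=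
  (QuotientGroup.eq_one_iff _).2 (mem_sup_left (subset_normalClosure ⟨a, ha, rfl⟩))

lemma lowerCentralSeries_eq_bot : (⊤ : Subgroup (NilCoprod k R B)).lowerCentralSeries k = ⊥ := by
  have h := map_lowerCentralSeries (⊤ : Subgroup (Monoid.Coprod A B))
    (QuotientGroup.mk' (relations k R B)) k
  rw [map_top_of_surjective _ (QuotientGroup.mk'_surjective _)] at h
  rw [← h, eq_bot_iff, map_le_iff_le_comap, MonoidHom.comap_bot, QuotientGroup.ker_mk']
  exact le_sup_right

/-- The universal property of the coproduct. -/
def lift (hH : (⊤ : Subgroup H).lowerCentralSeries k = ⊥) (f : A →* H) (g : B →* H)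
    (hf : ∀ a ∈ R, f a = 1) : NilCoprod k R B →* H :=
  QuotientGroup.lift _ (Monoid.Coprod.lift f g) (by
    refine sup_le (normalClosure_le_normal ?_) ?_
    · rintro _ ⟨a, ha, rfl⟩
      exact (Monoid.Coprod.lift_apply_inl f g a).trans (hf a ha)
    · have h := map_lowerCentralSeries (⊤ : Subgroup (Monoid.Coprod A B)) (Monoid.Coprod.lift f g) k
      have h' : (Subgroup.map (Monoid.Coprod.lift f g) ⊤).lowerCentralSeries k ≤
        (⊤ : Subgroup H).lowerCentralSeries k := (lowerCentralSeries_mono k (le_top (a := map (Monoid.Coprod.lift f g) ⊤)))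
      rw [← h, hH, map_le_iff_le_comap, MonoidHom.comap_bot] at h'
      exact h')

@[simp]
lemma lift_inl (hH : (⊤ : Subgroup H).lowerCentralSeries k = ⊥) (f : A →* H) (g : B →* H)
    (hf : ∀ a ∈ R, f a = 1) (a : A) : lift hH f g hf (inl k R B a) = f a :=
  Monoid.Coprod.lift_apply_inl f g a

@[simp]
lemma lift_inr (hH : (⊤ : Subgroup H).lowerCentralSeries k = ⊥) (f : A →* H) (g : B →* H)
    (hf : ∀ a ∈ R, f a = 1) (b : B) : lift hH f g hf (inr k R B b) = g b :=
  Monoid.Coprod.lift_apply_inr f g b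

lemma hom_ext {f g : NilCoprod k R B →* H} (h₁ : ∀ a, f (inl k R B a) = g (inl k R B a))
    (h₂ : ∀ b, f (inr k R B b) = g (inr k R B b)) : f = g :=
  QuotientGroup.monoidHom_ext _ (Monoid.Coprod.hom_ext (MonoidHom.ext h₁) (MonoidHom.ext h₂))

lemma range_sup_range : (inl k R B).range ⊔ (inr k R B).range = ⊤ := by
  rw [inl, inr, MonoidHom.range_comp, MonoidHom.range_comp, ← Subgroup.map_sup,
    Monoid.Coprod.range_inl_sup_range_inr, map_top_of_surjective _ (QuotientGroup.mk'_surjective _)]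

/-- Functoriality of the coproduct. -/
def map (f : A →* A') (g : B →* B') (hf : ∀ a ∈ R, f a ∈ R') :
    NilCoprod k R B →* NilCoprod k R' B' :=
  lift lowerCentralSeries_eq_bot ((inl k R' B').comp f) ((inr k R' B').comp g)
    fun a ha => inl_eq_one (hf a ha)

@[simp]
lemma map_inl (f : A →* A') (g : B →* B') (hf : ∀ a ∈ R, f a ∈ R') (a : A) :
    map (k := k) f g hf (inl k R B a) = inl k R' B' (f a) := lift_inl _ _ _ _ _

@[simp]
lemma map_inr (f : A →* A') (g : B →* B') (hf : ∀ a ∈ R, f a ∈ R') (b : B) :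
    map (k := k) f g hf (inr k R B b) = inr k R' B' (g b) := lift_inr _ _ _ _ _

end NilCoprod

/-! ## Levelwise properties of push-outs of simplicial `nil(k)`-groups -/

namespace SNil

open SGrp

variable {k : ℕ}

/-- The group of `q`-simplices. -/
abbrev Level (X : SNilCat.{u} k) (q : ℕ) : GrpCat.{u} := ((forget k).obj X) _⦋q⦌

/-- The action of a simplicial operator. -/
abbrev act (X : SNilCat.{u} k) {p q : ℕ} (α : ⦋q⦌ ⟶ ⦋p⦌) : Level X p →* Level X q :=
  (((forget k).obj X).map α.op).hom

/-- The action of a map on `q`-simplices. -/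
abbrev lev {X Y : SNilCat.{u} k} (f : X ⟶ Y) (q : ℕ) : Level X q →* Level Y q :=
  app ((forget k).map f) q

lemma isNil_level (X : SNilCat.{u} k) (q : ℕ) : IsNil k (Level X q) := (X.obj (op ⦋q⦌)).property

lemma act_id (X : SNilCat.{u} k) (p : ℕ) (x : Level X p) : act X (𝟙 ⦋p⦌) x = x :=
  ConcreteCategory.congr_hom (((forget k).obj X).map_id (op ⦋p⦌)) x

lemma act_act (X : SNilCat.{u} k) {p q r : ℕ} (α : ⦋q⦌ ⟶ ⦋p⦌) (β : ⦋r⦌ ⟶ ⦋q⦌) (x : Level X p) :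
    act X β (act X α x) = act X (β ≫ α) x :=
  ConcreteCategory.congr_hom (((forget k).obj X).map_comp α.op β.op).symm x

lemma lev_act {X Y : SNilCat.{u} k} (f : X ⟶ Y) {p q : ℕ} (α : ⦋q⦌ ⟶ ⦋p⦌) (x : Level X p) :
    lev f q (act X α x) = act Y α (lev f p x) :=
  ConcreteCategory.congr_hom (((forget k).map f).naturality α.op) x

/-- The right adjoint of the evaluation at `⦋q⦌`, applied to a `nil(k)`-group. -/
def coskel (q : ℕ) (H : GrpCat.{u}) (hH : IsNil k H) : SNilCat.{u} k where
  obj a := ⟨GrpCat.of ((⦋q⦌ ⟶ a.unop) → H), by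
    have h := Subgroup.top_lowerCentralSeries_pi_le (Gs := fun _ : (⦋q⦌ ⟶ a.unop) => H) k
    change (⊤ : Subgroup ((⦋q⦌ ⟶ a.unop) → H)).lowerCentralSeries k = ⊥
    rw [eq_bot_iff]
    refine h.trans fun f hf => ?_
    rw [Subgroup.mem_bot]
    funext β
    have := hf β (Set.mem_univ _)
    have hH' : (⊤ : Subgroup H).lowerCentralSeries k = ⊥ := hH
    simp only [hH'] at this
    exact Subgroup.mem_bot.1 this⟩
  map α := ObjectProperty.homMk (GrpCat.ofHom
    { toFun := fun f β => f (β ≫ α.unop)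
      map_one' := rfl
      map_mul' := fun _ _ => rfl })
  map_id a := by
    ext f β
    exact congrArg f (Category.comp_id β)
  map_comp α α' := by
    ext f β
    exact congrArg f (Category.assoc β α'.unop α.unop).symm

/-- The map to `coskel q H` which corresponds to a homomorphism. -/
def toCoskel {X : SNilCat.{u} k} {q : ℕ} {H : GrpCat.{u}} (hH : IsNil k H) (φ : Level X q →* H) :
    X ⟶ coskel q H hH where
  app a := ObjectProperty.homMk (GrpCat.ofHom
    { toFun := fun x β => φ ((((forget k).obj X).map β.op).hom x)
      map_one' := by funext β; exact (congrArg φ (map_one _)).trans (map_one _)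
      map_mul' := fun x y => by funext β; exact (congrArg φ (map_mul _ _ _)).trans (map_mul _ _ _) })
  naturality a b α := by
    ext x
    funext β
    exact congrArg φ (ConcreteCategory.congr_hom
      (((forget k).obj X).map_comp α β.op) x).symm

/-- The homomorphism which corresponds to a map to `coskel q H`. -/
def ofCoskel {X : SNilCat.{u} k} {q : ℕ} {H : GrpCat.{u}} {hH : IsNil k H}
    (g : X ⟶ coskel q H hH) : Level X q →* H :=
  (Pi.evalMonoidHom (fun _ : (⦋q⦌ ⟶ ⦋q⦌) => (H : Type u)) (𝟙 ⦋q⦌)).comp (lev g q)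

lemma ofCoskel_toCoskel {X : SNilCat.{u} k} {q : ℕ} {H : GrpCat.{u}} (hH : IsNil k H)
    (φ : Level X q →* H) (x : Level X q) : ofCoskel (toCoskel hH φ) x = φ x :=
  congrArg φ (act_id X q x)

lemma toCoskel_comp {X Y : SNilCat.{u} k} {q : ℕ} {H : GrpCat.{u}} (hH : IsNil k H)
    (f : X ⟶ Y) (φ : Level Y q →* H) : f ≫ toCoskel hH φ = toCoskel hH (φ.comp (lev f q)) := by
  ext a x
  funext β
  exact congrArg φ (ConcreteCategory.congr_hom (((forget k).map f).naturality β.op) x).symm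

/-! ### Push-outs of simplicial `nil(k)`-groups are computed degreewise. -/

section Pushout

variable {F M N P : SNilCat.{u} k} {f₁ : F ⟶ M} {f₂ : F ⟶ N} {i : M ⟶ P} {j : N ⟶ P}
  (h : IsPushout f₂ f₁ j i)
include h

lemma lev_comm (q : ℕ) (x : Level F q) : lev j q (lev f₂ q x) = lev i q (lev f₁ q x) :=
  app_comm (h.toCommSq.map (forget k)) q x

/-- Homomorphisms from the `q`-simplices to `H` are maps to `coskel q H`; evaluation in degree `q`
is a left adjoint and so preserves push-outs. -/
lemma exists_desc {q : ℕ} {H : GrpCat.{u}} (hH : IsNil k H) (φ : Level M q →* H)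
    (ψ : Level N q →* H) (hφψ : ∀ x, φ (lev f₁ q x) = ψ (lev f₂ q x)) :
    ∃ χ : Level P q →* H, (∀ x, χ (lev i q x) = φ x) ∧ ∀ y, χ (lev j q y) = ψ y := by
  have w : f₂ ≫ toCoskel hH ψ = f₁ ≫ toCoskel hH φ := by
    rw [toCoskel_comp, toCoskel_comp]
    congr 1
    exact MonoidHom.ext fun x => (hφψ x).symm
  refine ⟨ofCoskel (h.desc _ _ w), fun x => ?_, fun y => ?_⟩
  · exact (congrArg (fun g => ofCoskel g x) (h.inr_desc _ _ w)).trans (ofCoskel_toCoskel hH φ x)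
  · exact (congrArg (fun g => ofCoskel g y) (h.inl_desc _ _ w)).trans (ofCoskel_toCoskel hH ψ y)

lemma desc_ext {q : ℕ} {H : GrpCat.{u}} (hH : IsNil k H) {χ χ' : Level P q →* H}
    (h₁ : ∀ x, χ (lev i q x) = χ' (lev i q x)) (h₂ : ∀ x, χ (lev j q x) = χ' (lev j q x)) :
    χ = χ' := by
  have : toCoskel hH χ = toCoskel hH χ' := by
    refine h.hom_ext ?_ ?_
    · rw [toCoskel_comp, toCoskel_comp]
      exact congrArg _ (MonoidHom.ext h₂)
    · rw [toCoskel_comp, toCoskel_comp]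
      exact congrArg _ (MonoidHom.ext h₁)
  ext x
  rw [← ofCoskel_toCoskel hH χ x, this, ofCoskel_toCoskel]

end Pushout

/-! ### Freeness in a single degree. -/

section Free

variable {X Z : SNilCat.{u} k} {f : X ⟶ Z} {C : ∀ q : ℕ, Set (Level Z q)} (hf : IsFreeMapOn f C)
include hf

lemma free_exists_hom {q : ℕ} {H : GrpCat.{u}} (hH : IsNil k H) (φ : Level X q →* H)
    (t : C q → H) : ∃ ψ : Level Z q →* H, (∀ x, ψ (lev f q x) = φ x) ∧ ∀ c : C q, ψ c = t c :=
  (hf.exists_unique_hom q H hH φ t).exists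

lemma free_hom_ext {q : ℕ} {H : GrpCat.{u}} (hH : IsNil k H) {ψ ψ' : Level Z q →* H}
    (h₁ : ∀ x, ψ (lev f q x) = ψ' (lev f q x)) (h₂ : ∀ c ∈ C q, ψ c = ψ' c) : ψ = ψ' :=
  (hf.exists_unique_hom q H hH (ψ.comp (lev f q)) (fun c => ψ c)).unique ⟨fun _ => rfl, fun _ => rfl⟩
    ⟨fun x => (h₁ x).symm, fun c => (h₂ c c.2).symm⟩

lemma free_exists_retraction (q : ℕ) : ∃ ρ : Level Z q →* Level X q, ∀ x, ρ (lev f q x) = x := by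
  obtain ⟨ρ, hρ, -⟩ := free_exists_hom hf (isNil_level X q) (MonoidHom.id _) (fun _ => 1)
  exact ⟨ρ, hρ⟩

/-- Without new generators, the retraction is a two-sided inverse. -/
lemma free_surjective {q : ℕ} (hC : C q = ∅) : Function.Surjective (lev f q) := by
  obtain ⟨ρ, hρ⟩ := free_exists_retraction hf q
  have h := free_hom_ext hf (isNil_level Z q) (ψ := (lev f q).comp ρ) (ψ' := MonoidHom.id _)
    (fun x => congrArg (lev f q) (hρ x)) (fun c hc => by simp [hC] at hc)
  exact fun z => ⟨ρ z, DFunLike.congr_fun h z⟩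

end Free

end SNil

/-! ## The weighted series of a push-out -/

namespace SNil

open SGrp WeightedSeries

variable {k : ℕ}

/-- The operators of a simplicial `nil(k)`-group, indexed by natural numbers. -/
def nsimp (X : SNilCat.{u} k) : NSimp fun q => Level X q :=
  NSimp.ofMaps (fun α => act X α) (act_id X) (fun α β x => act_act X α β x)

lemma nsimp_d (X : SNilCat.{u} k) {n : ℕ} (i : Fin (n + 2)) (x : Level X (n + 1)) :
    (nsimp X).d n i x = face ((forget k).obj X) n i x :=
  NSimp.ofMaps_d (X := fun q => Level X q) (fun α => act X α) (act_id X)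
    (fun α β x => act_act X α β x) i.2 x

variable {F M N P : SNilCat.{u} k} {f₁ : F ⟶ M} {f₂ : F ⟶ N} {i : M ⟶ P} {j : N ⟶ P}
  {C : ∀ q : ℕ, Set (Level M q)} {D : ∀ q : ℕ, Set (Level N q)}

/-- The image of a map on `q`-simplices. -/
abbrev im {X Y : SNilCat.{u} k} (f : X ⟶ Y) (q : ℕ) : Subgroup (Level Y q) := (lev f q).range

lemma act_mem_im {X Y : SNilCat.{u} k} (f : X ⟶ Y) {p q : ℕ} (α : ⦋q⦌ ⟶ ⦋p⦌) (x : Level Y p)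
    (hx : x ∈ im f p) : act Y α x ∈ im f q := by
  obtain ⟨x, rfl⟩ := hx
  exact ⟨act X α x, lev_act f α x⟩

lemma isSub_im {X Y : SNilCat.{u} k} (f : X ⟶ Y) : (nsimp Y).IsSub (im f) :=
  NSimp.isSub_ofMaps _ _ _ (fun α x hx => act_mem_im f α x hx)

section

variable (h : IsPushout f₂ f₁ j i) (hC : IsFreeMapOn f₁ C) (hD : IsFreeMapOn f₂ D)
include h

lemma lev_mem_W_two (q : ℕ) (x : Level F q) : lev i q (lev f₁ q x) ∈ W (im j q) 2 := by
  rw [← lev_comm h]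
  exact (isSeries_W _).le_two ⟨_, rfl⟩

-- Glue the identity of M with a retraction of N onto F that kills the free generators. This is a
-- construction in one degree, with no compatibility with the simplicial operators.
include hD in
lemma exists_retraction_left (q : ℕ) : ∃ ρ : Level P q →* Level M q, (∀ x, ρ (lev i q x) = x) ∧
    ∀ y, ρ (lev j q y) ∈ im f₁ q := by
  obtain ⟨r, hr⟩ := free_exists_retraction hD q
  obtain ⟨ρ, h₁, h₂⟩ := exists_desc h (isNil_level M q) (MonoidHom.id _) ((lev f₁ q).comp r)
    (fun x => by
      rw [MonoidHom.comp_apply, hr]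
      rfl)
  exact ⟨ρ, h₁, fun y => ⟨r y, (h₂ y).symm⟩⟩

include hC in
lemma exists_retraction_right (q : ℕ) : ∃ ρ : Level P q →* Level N q, (∀ y, ρ (lev j q y) = y) ∧
    ∀ x, ρ (lev i q x) ∈ im f₂ q := by
  obtain ⟨r, hr⟩ := free_exists_retraction hC q
  obtain ⟨ρ, h₁, h₂⟩ := exists_desc h (isNil_level N q) ((lev f₂ q).comp r) (MonoidHom.id _)
    (fun x => by
      rw [MonoidHom.comp_apply, hr]
      rfl)
  exact ⟨ρ, h₂, fun y => ⟨r y, (h₁ y).symm⟩⟩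

lemma lev_i_mem_inf {q : ℕ} {x : Level M q} (hx : x ∈ im f₁ q) :
    lev i q x ∈ im i q ⊓ im j q := by
  obtain ⟨x, rfl⟩ := hx
  exact ⟨⟨_, rfl⟩, ⟨_, lev_comm h q x⟩⟩

lemma lev_j_mem_inf {q : ℕ} {x : Level N q} (hx : x ∈ im f₂ q) :
    lev j q x ∈ im i q ⊓ im j q := by
  obtain ⟨x, rfl⟩ := hx
  exact ⟨⟨_, (lev_comm h q x).symm⟩, ⟨_, rfl⟩⟩

include hC hD

/-- For `left_mem`, the retraction of P onto M fixes `ν * e`, sends `ν` into F, and preserves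
weights because it sends N into F, which lies in N. Symmetrically for `right_mem`. -/
lemma filteredTriad : (nsimp P).FilteredTriad (im i) (im j) (fun w q => W (im j q) w) where
  isSub_left := isSub_im i
  isSub_right := isSub_im j
  isSub_W w := NSimp.isSub_ofMaps _ _ _ (fun α _ hx => map_mem_W _ (act_mem_im j α) hx)
  normal w n := inferInstance
  succ_le w n := (isSeries_W _).succ_le w
  central w n := commutator_W_top_le w
  left_mem w q ν hν e he := by
    rintro ⟨⟨x, hx⟩, hW⟩
    obtain ⟨ρ, h₁, h₂⟩ := exists_retraction_left h hD q
    have hρ : ∀ z ∈ im j q, lev i q (ρ z) ∈ im i q ⊓ im j q := by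
      rintro _ ⟨y, rfl⟩
      exact lev_i_mem_inf h (h₂ y)
    have hρW : ∀ {w} {z : Level P q}, z ∈ W (im j q) w → lev i q (ρ z) ∈ W (im j q) w :=
      fun hz => map_mem_W ((lev i q).comp ρ) (fun z hz => (hρ z hz).2) hz
    have hρe : lev i q (ρ e) ∈ W (im j q) (w + 1) := hρW he
    have e1 : ν * e = lev i q (ρ ν) * lev i q (ρ e) := by
      rw [← map_mul, ← map_mul, ← hx, h₁]
    have hρν : lev i q (ρ ν) ∈ W (im j q) w := by
      have := mul_mem hW (Subgroup.inv_mem _ ((isSeries_W (im j q)).succ_le w hρe))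
      rwa [e1, mul_inv_cancel_right] at this
    rw [e1]
    exact mul_mem (Subgroup.mem_sup_left ⟨hρ ν hν, hρν⟩) (Subgroup.mem_sup_right hρe)
  right_mem w q ν hν e he := by
    rintro ⟨⟨x, hx⟩, hW⟩
    obtain ⟨ρ, h₁, h₂⟩ := exists_retraction_right h hC q
    have hρ : ∀ z ∈ im i q, lev j q (ρ z) ∈ im i q ⊓ im j q := by
      rintro _ ⟨y, rfl⟩
      exact lev_j_mem_inf h (h₂ y)
    have hρW : ∀ {w} {z : Level P q}, z ∈ W (im j q) w → lev j q (ρ z) ∈ W (im j q) w :=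
      fun hz => map_mem_W (B := im j q) (B' := im j q) ((lev j q).comp ρ) (fun z _ => MonoidHom.mem_range.2 ⟨ρ z, rfl⟩) hz
    have hρe : lev j q (ρ e) ∈ W (im j q) (w + 1) := hρW he
    have e1 : ν * e = lev j q (ρ ν) * lev j q (ρ e) := by
      rw [← map_mul, ← map_mul, ← hx, h₁]
    have hρν : lev j q (ρ ν) ∈ W (im j q) w := by
      have := mul_mem hW (Subgroup.inv_mem _ ((isSeries_W (im j q)).succ_le w hρe))
      rwa [e1, mul_inv_cancel_right] at this
    rw [e1]
    exact mul_mem (Subgroup.mem_sup_left ⟨hρ ν hν, hρν⟩) (Subgroup.mem_sup_right hρe)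

end

/-! ### The bisimplicial model -/

/-- The coproduct of the cofibre of `f₁` in degree `p` with `N` in degree `q`. -/
abbrev Model (f₁ : F ⟶ M) (N : SNilCat.{u} k) (p q : ℕ) :=
  NilCoprod k (im f₁ p : Set (Level M p)) (Level N q)

/-- The inclusion of `M` into the bisimplicial model. -/
abbrev modelInl (f₁ : F ⟶ M) (N : SNilCat.{u} k) (p q : ℕ) : Level M p →* Model f₁ N p q :=
  NilCoprod.inl k (im f₁ p : Set (Level M p)) (Level N q)

/-- The inclusion of `N` into the bisimplicial model. -/
abbrev modelInr (f₁ : F ⟶ M) (N : SNilCat.{u} k) (p q : ℕ) : Level N q →* Model f₁ N p q :=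
  NilCoprod.inr k (im f₁ p : Set (Level M p)) (Level N q)

/-- The operators of the bisimplicial model. -/
def modelMap (f₁ : F ⟶ M) (N : SNilCat.{u} k) {p q p' q' : ℕ} (α : ⦋p'⦌ ⟶ ⦋p⦌)
    (β : ⦋q'⦌ ⟶ ⦋q⦌) : Model f₁ N p q →* Model f₁ N p' q' :=
  NilCoprod.map (act M α) (act N β) fun x hx => act_mem_im f₁ α x hx

lemma modelMap_id (p q : ℕ) (x : Model f₁ N p q) : modelMap f₁ N (𝟙 ⦋p⦌) (𝟙 ⦋q⦌) x = x := by
  have : modelMap f₁ N (𝟙 ⦋p⦌) (𝟙 ⦋q⦌) = MonoidHom.id _ :=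
    NilCoprod.hom_ext (fun a => by rw [modelMap, NilCoprod.map_inl, act_id]; rfl)
      (fun b => by rw [modelMap, NilCoprod.map_inr, act_id]; rfl)
  exact DFunLike.congr_fun this x

lemma modelMap_modelMap {p q p' q' p'' q'' : ℕ} (α : ⦋p'⦌ ⟶ ⦋p⦌) (β : ⦋q'⦌ ⟶ ⦋q⦌)
    (α' : ⦋p''⦌ ⟶ ⦋p'⦌) (β' : ⦋q''⦌ ⟶ ⦋q'⦌) (x : Model f₁ N p q) :
    modelMap f₁ N α' β' (modelMap f₁ N α β x) = modelMap f₁ N (α' ≫ α) (β' ≫ β) x := by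
  have : (modelMap f₁ N α' β').comp (modelMap f₁ N α β) = modelMap f₁ N (α' ≫ α) (β' ≫ β) :=
    NilCoprod.hom_ext
      (fun a => by
        simp only [MonoidHom.comp_apply, modelMap, NilCoprod.map_inl]
        rw [act_act])
      (fun b => by
        simp only [MonoidHom.comp_apply, modelMap, NilCoprod.map_inr]
        rw [act_act])
  exact DFunLike.congr_fun this x

/-- The subgroup of the bisimplicial model which corresponds to `M`. -/
abbrev modelLeft (f₁ : F ⟶ M) (f₂ : F ⟶ N) (p q : ℕ) : Subgroup (Model f₁ N p q) :=
  (modelInl f₁ N p q).range ⊔ (im f₂ q).map (modelInr f₁ N p q)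

/-- The subgroup of the bisimplicial model which corresponds to `N`. -/
abbrev modelRight (f₁ : F ⟶ M) (N : SNilCat.{u} k) (p q : ℕ) : Subgroup (Model f₁ N p q) :=
  (modelInr f₁ N p q).range

lemma modelMap_mem_left {p q p' q' : ℕ} (α : ⦋p'⦌ ⟶ ⦋p⦌) (β : ⦋q'⦌ ⟶ ⦋q⦌) :
    ∀ x ∈ modelLeft f₁ f₂ p q, modelMap f₁ N α β x ∈ modelLeft f₁ f₂ p' q' := by
  change _ ≤ (modelLeft f₁ f₂ p' q').comap (modelMap f₁ N α β)
  refine sup_le ?_ ?_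
  · rintro _ ⟨a, rfl⟩
    exact Subgroup.mem_sup_left ⟨act M α a, (NilCoprod.map_inl _ _ _ _).symm⟩
  · rintro _ ⟨b, hb, rfl⟩
    exact Subgroup.mem_sup_right
      ⟨act N β b, act_mem_im f₂ β b hb, (NilCoprod.map_inr _ _ _ _).symm⟩

lemma modelMap_mem_right {p q p' q' : ℕ} (α : ⦋p'⦌ ⟶ ⦋p⦌) (β : ⦋q'⦌ ⟶ ⦋q⦌) :
    ∀ x ∈ modelRight f₁ N p q, modelMap f₁ N α β x ∈ modelRight f₁ N p' q' := by
  rintro _ ⟨b, rfl⟩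
  exact ⟨act N β b, (NilCoprod.map_inr _ _ _ _).symm⟩

/-- The bisimplicial abelian groups formed by the graded pieces of the model. -/
abbrev ModelPiece (f₁ : F ⟶ M) (f₂ : F ⟶ N) (w p q : ℕ) :=
  GradedPiece (modelLeft f₁ f₂ p q) (modelRight f₁ N p q) w

/-- The operators of the graded pieces of the model. -/
def modelPieceMap (f₁ : F ⟶ M) (f₂ : F ⟶ N) (w : ℕ) {p q p' q' : ℕ} (α : ⦋p'⦌ ⟶ ⦋p⦌)
    (β : ⦋q'⦌ ⟶ ⦋q⦌) : ModelPiece f₁ f₂ w p q →* ModelPiece f₁ f₂ w p' q' :=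
  GradedPiece.map w (modelMap f₁ N α β) (modelMap_mem_left α β) (modelMap_mem_right α β)

lemma modelPieceMap_id (w p q : ℕ) (x : ModelPiece f₁ f₂ w p q) :
    modelPieceMap f₁ f₂ w (𝟙 ⦋p⦌) (𝟙 ⦋q⦌) x = x := by
  obtain ⟨⟨x, hx⟩, rfl⟩ := QuotientGroup.mk_surjective x
  rw [modelPieceMap, GradedPiece.map_mk]
  congr 2
  exact modelMap_id p q x

lemma modelPieceMap_modelPieceMap (w : ℕ) {p q p' q' p'' q'' : ℕ} (α : ⦋p'⦌ ⟶ ⦋p⦌)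
    (β : ⦋q'⦌ ⟶ ⦋q⦌) (α' : ⦋p''⦌ ⟶ ⦋p'⦌) (β' : ⦋q''⦌ ⟶ ⦋q'⦌) (x : ModelPiece f₁ f₂ w p q) :
    modelPieceMap f₁ f₂ w α' β' (modelPieceMap f₁ f₂ w α β x) =
      modelPieceMap f₁ f₂ w (α' ≫ α) (β' ≫ β) x := by
  obtain ⟨⟨x, hx⟩, rfl⟩ := QuotientGroup.mk_surjective x
  simp only [modelPieceMap, GradedPiece.map_mk]
  congr 2
  exact modelMap_modelMap α β α' β' x

/-- The graded pieces of the model as a bisimplicial abelian group. -/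
def modelPiece (f₁ : F ⟶ M) (f₂ : F ⟶ N) (w : ℕ) : BiSimp (ModelPiece f₁ f₂ w) :=
  BiSimp.ofMaps (fun α β => modelPieceMap f₁ f₂ w α β) (modelPieceMap_id w)
    (fun α β α' β' x => modelPieceMap_modelPieceMap w α β α' β' x)

/-- If M_p = F_p the model is generated by N_q alone; if N_q = F_q the subgroup `modelLeft` is
everything. In both cases all elements are decomposable. -/
lemma modelPiece_subsingleton (w p q : ℕ)
    (hpq : Function.Surjective (lev f₁ p) ∨ Function.Surjective (lev f₂ q)) :
    Subsingleton (ModelPiece f₁ f₂ w p q) := by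
  have htop : (modelInl f₁ N p q).range ⊔ (modelInr f₁ N p q).range = ⊤ :=
    NilCoprod.range_sup_range
  refine GradedPiece.subsingleton (hpq.symm.imp (fun h => ?_) fun h => ?_) w
  · rw [modelLeft, eq_top_iff, ← htop]
    refine sup_le_sup_left ?_ _
    rintro _ ⟨y, rfl⟩
    obtain ⟨x, rfl⟩ := h y
    exact Subgroup.mem_map_of_mem _ ⟨x, rfl⟩
  · rw [modelRight, ← htop, eq_comm, sup_eq_right]
    rintro _ ⟨a, rfl⟩
    rw [modelInl, NilCoprod.inl_eq_one (R := (im f₁ p : Set (Level M p))) (h a)]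
    exact one_mem _

lemma isNil_of_injective {G H : Type*} [Group G] [Group H] {k : ℕ} (f : G →* H)
    (hf : Function.Injective f) (hH : (⊤ : Subgroup H).lowerCentralSeries k = ⊥) :
    (⊤ : Subgroup G).lowerCentralSeries k = ⊥ := by
  have h := Subgroup.map_lowerCentralSeries (⊤ : Subgroup G) f k
  have h' : (Subgroup.map f ⊤).lowerCentralSeries k ≤ (⊤ : Subgroup H).lowerCentralSeries k :=
    Subgroup.lowerCentralSeries_mono k le_top
  rw [← h, hH, le_bot_iff, Subgroup.map_eq_bot_iff_of_injective _ hf] at h'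
  exact h'

lemma isNil_quotient {G : Type*} [Group G] {k : ℕ} (K : Subgroup G) [K.Normal]
    (hG : (⊤ : Subgroup G).lowerCentralSeries k = ⊥) :
    (⊤ : Subgroup (G ⧸ K)).lowerCentralSeries k = ⊥ := by
  have h := Subgroup.map_lowerCentralSeries (⊤ : Subgroup G) (QuotientGroup.mk' K) k
  rw [Subgroup.map_top_of_surjective _ (QuotientGroup.mk'_surjective _), hG, Subgroup.map_bot] at h
  exact h.symm

section

variable (h : IsPushout f₂ f₁ j i) (hC : IsFreeMapOn f₁ C)
include h hC

/-- Comparison of the push-out with the diagonal of the model. -/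
lemma exists_comparison (q : ℕ) : ∃ θ : Level P q →* Model f₁ N q q,
    (∀ y, θ (lev j q y) = modelInr f₁ N q q y) ∧
    (∀ c ∈ C q, θ (lev i q c) = modelInl f₁ N q q c) ∧
    (∀ x, ((θ (lev i q x) : Model f₁ N q q) : Model f₁ N q q ⧸ W (modelRight f₁ N q q) 2) =
      modelInl f₁ N q q x) ∧ ∀ x, θ (lev i q x) ∈ modelLeft f₁ f₂ q q := by
  have hG : (⊤ : Subgroup (Model f₁ N q q)).lowerCentralSeries k = ⊥ :=
    NilCoprod.lowerCentralSeries_eq_bot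
  have hL : IsNil k (GrpCat.of (modelLeft f₁ f₂ q q)) :=
    isNil_of_injective (modelLeft f₁ f₂ q q).subtype (Subgroup.subtype_injective _) hG
  -- `τ` fixes the free generators and sends F to the model through N.
  obtain ⟨τ, hτ, hτC⟩ := free_exists_hom hC hL
    (((modelInr f₁ N q q).comp (lev f₂ q)).codRestrict (modelLeft f₁ f₂ q q)
      (fun x => Subgroup.mem_sup_right ⟨_, ⟨x, rfl⟩, rfl⟩))
    (fun c => ⟨modelInl f₁ N q q c, Subgroup.mem_sup_left ⟨c, rfl⟩⟩)
  have hτ' : ∀ x, ((τ (lev f₁ q x) : modelLeft f₁ f₂ q q) : Model f₁ N q q) =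
      modelInr f₁ N q q (lev f₂ q x) := fun x => congrArg Subtype.val (hτ x)
  obtain ⟨θ, hθi, hθj⟩ := exists_desc h (H := GrpCat.of (Model f₁ N q q)) hG
    ((modelLeft f₁ f₂ q q).subtype.comp τ) (modelInr f₁ N q q) hτ'
  refine ⟨θ, hθj, fun c hc => (hθi c).trans (congrArg Subtype.val (hτC ⟨c, hc⟩)), fun x => ?_,
    fun x => ?_⟩
  -- The two maps agree on the generators, and on F both have values of weight 2.
  · have := free_hom_ext hC (H := GrpCat.of (Model f₁ N q q ⧸ W (modelRight f₁ N q q) 2))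
      (isNil_quotient _ hG)
      (ψ := (QuotientGroup.mk' _).comp ((modelLeft f₁ f₂ q q).subtype.comp τ))
      (ψ' := (QuotientGroup.mk' _).comp (modelInl f₁ N q q)) (fun x => ?_) (fun c hc => ?_)
    · rw [hθi]
      exact DFunLike.congr_fun this x
    · change (((τ (lev f₁ q x) : modelLeft f₁ f₂ q q) : Model f₁ N q q) :
        Model f₁ N q q ⧸ W (modelRight f₁ N q q) 2) = (modelInl f₁ N q q (lev f₁ q x) : _)
      rw [hτ', NilCoprod.inl_eq_one (R := (im f₁ q : Set (Level M q))) ⟨x, rfl⟩,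
        QuotientGroup.mk_one, QuotientGroup.eq_one_iff]
      exact (isSeries_W _).le_two ⟨_, rfl⟩
    · exact congrArg (fun z : modelLeft f₁ f₂ q q =>
        ((z : Model f₁ N q q) : Model f₁ N q q ⧸ W (modelRight f₁ N q q) 2)) (hτC ⟨c, hc⟩)
  · rw [hθi]
    exact (τ x).2

/-- Comparison of the diagonal of the model with the push-out. -/
lemma exists_inverse_comparison (q : ℕ) : ∃ η : Model f₁ N q q →* Level P q,
    (∀ y, η (modelInr f₁ N q q y) = lev j q y) ∧
    (∀ c ∈ C q, η (modelInl f₁ N q q c) = lev i q c) ∧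
    (∀ x, ((η (modelInl f₁ N q q x) : Level P q) : Level P q ⧸ W (im j q) 2) = lev i q x) ∧
    ∀ x, η (modelInl f₁ N q q x) ∈ im i q := by
  have hP : (⊤ : Subgroup (Level P q)).lowerCentralSeries k = ⊥ := isNil_level P q
  -- `κ` kills F and fixes the generators, so it realizes M_q / F_q inside M_q.
  obtain ⟨κ, hκ, hκC⟩ := free_exists_hom hC (isNil_level M q) (1 : Level F q →* Level M q)
    (fun c => c)
  refine ⟨NilCoprod.lift hP ((lev i q).comp κ) (lev j q) ?_, fun y => ?_,
    fun c hc => ?_, fun x => ?_, fun x => ?_⟩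
  · rintro _ ⟨x, rfl⟩
    exact (congrArg (lev i q) (hκ x)).trans (map_one _)
  · exact NilCoprod.lift_inr _ _ _ _ _
  · exact (NilCoprod.lift_inl _ _ _ _ _).trans (congrArg (lev i q) (hκC ⟨c, hc⟩))
  · rw [modelInl, NilCoprod.lift_inl]
    have := free_hom_ext hC (H := GrpCat.of (Level P q ⧸ W (im j q) 2))
      (isNil_quotient _ (isNil_level P q)) (ψ := (QuotientGroup.mk' _).comp ((lev i q).comp κ))
      (ψ' := (QuotientGroup.mk' _).comp (lev i q)) (fun x => ?_) (fun c hc => ?_)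
    · exact DFunLike.congr_fun this x
    · change ((lev i q (κ (lev f₁ q x)) : Level P q) : Level P q ⧸ W (im j q) 2) =
        (lev i q (lev f₁ q x) : _)
      rw [hκ, MonoidHom.one_apply, map_one, QuotientGroup.mk_one, eq_comm,
        QuotientGroup.eq_one_iff]
      exact lev_mem_W_two h q x
    · exact congrArg (fun z => ((lev i q z : Level P q) : Level P q ⧸ W (im j q) 2)) (hκC ⟨c, hc⟩)
  · rw [modelInl, NilCoprod.lift_inl]
    exact ⟨_, rfl⟩

end

lemma mk_map_eq_mk_map {G H : Type*} [Group G] [Group H] {B : Subgroup G} {B' : Subgroup H}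
    (f : G →* H) (hf : ∀ x ∈ B, f x ∈ B') {w : ℕ} {x y : G} (hxy : (x : G ⧸ W B w) = y) :
    (f x : H ⧸ W B' w) = f y := by
  rw [QuotientGroup.eq] at hxy ⊢
  rw [← map_inv, ← map_mul]
  exact map_mem_W f hf hxy

section

variable (h : IsPushout f₂ f₁ j i)
include h

/-- `θ` keeps the part in F of an operator applied to a generator, while the model forgets it. The
two ways round agree exactly on N and modulo weight 2 in general, so `mk_eq_mk_of_mem_W` applies. -/
lemma comparison_congr {p q : ℕ} (α : ⦋q⦌ ⟶ ⦋p⦌) {θ : Level P p →* Model f₁ N p p}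
    {θ' : Level P q →* Model f₁ N q q} (hj : ∀ y, θ (lev j p y) = modelInr f₁ N p p y)
    (hj' : ∀ y, θ' (lev j q y) = modelInr f₁ N q q y)
    (hi : ∀ x, ((θ (lev i p x) : Model f₁ N p p) : Model f₁ N p p ⧸ W (modelRight f₁ N p p) 2) =
      modelInl f₁ N p p x)
    (hi' : ∀ x, ((θ' (lev i q x) : Model f₁ N q q) :
      Model f₁ N q q ⧸ W (modelRight f₁ N q q) 2) = modelInl f₁ N q q x)
    {w : ℕ} {x : Level P p} (hx : x ∈ W (im j p) w) :
    ((θ' (act P α x) : Model f₁ N q q) : Model f₁ N q q ⧸ W (modelRight f₁ N q q) (w + 1)) =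
      modelMap f₁ N α α (θ x) := by
  have hj'' : ∀ y, θ' (act P α (lev j p y)) = modelMap f₁ N α α (θ (lev j p y)) := by
    intro y
    rw [← lev_act, hj', hj]
    exact (NilCoprod.map_inr _ _ _ _).symm
  refine mk_eq_mk_of_mem_W (B := im j p) (θ'.comp (act P α)) ((modelMap f₁ N α α).comp θ) ?_ ?_ ?_
    hx
  · rintro _ ⟨y, rfl⟩
    rw [MonoidHom.comp_apply, ← lev_act, hj']
    exact ⟨_, rfl⟩
  · have hG : (⊤ : Subgroup (Model f₁ N q q)).lowerCentralSeries k = ⊥ :=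
      NilCoprod.lowerCentralSeries_eq_bot
    have := desc_ext h (H := GrpCat.of (Model f₁ N q q ⧸ W (modelRight f₁ N q q) 2))
      (isNil_quotient _ hG)
      (χ := (QuotientGroup.mk' _).comp (θ'.comp (act P α)))
      (χ' := (QuotientGroup.mk' _).comp ((modelMap f₁ N α α).comp θ)) (fun x => ?_) (fun y => ?_)
    · exact fun x => DFunLike.congr_fun this x
    · have h₁ := mk_map_eq_mk_map (modelMap f₁ N α α) (modelMap_mem_right α α) (hi x)
      change ((θ' (act P α (lev i p x)) : Model f₁ N q q) :
        Model f₁ N q q ⧸ W (modelRight f₁ N q q) 2) = (modelMap f₁ N α α (θ (lev i p x)) : _)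
      rw [h₁, ← lev_act, hi']
      exact congrArg _ (NilCoprod.map_inl _ _ _ _).symm
    · exact congrArg (QuotientGroup.mk' (W (modelRight f₁ N q q) 2)) (hj'' y)
  · rintro _ ⟨y, rfl⟩
    exact hj'' y

omit h in
lemma inverse_comparison_congr {p q : ℕ} (α : ⦋q⦌ ⟶ ⦋p⦌) {η : Model f₁ N p p →* Level P p}
    {η' : Model f₁ N q q →* Level P q} (hj : ∀ y, η (modelInr f₁ N p p y) = lev j p y)
    (hj' : ∀ y, η' (modelInr f₁ N q q y) = lev j q y)
    (hi : ∀ x, ((η (modelInl f₁ N p p x) : Level P p) : Level P p ⧸ W (im j p) 2) = lev i p x)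
    (hi' : ∀ x, ((η' (modelInl f₁ N q q x) : Level P q) : Level P q ⧸ W (im j q) 2) = lev i q x)
    {w : ℕ} {x : Model f₁ N p p} (hx : x ∈ W (modelRight f₁ N p p) w) :
    ((act P α (η x) : Level P q) : Level P q ⧸ W (im j q) (w + 1)) =
      η' (modelMap f₁ N α α x) := by
  have hj'' : ∀ y, act P α (η (modelInr f₁ N p p y)) =
      η' (modelMap f₁ N α α (modelInr f₁ N p p y)) := by
    intro y
    rw [modelMap, NilCoprod.map_inr, hj', hj, lev_act]
  refine mk_eq_mk_of_mem_W (B := modelRight f₁ N p p) ((act P α).comp η)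
    (η'.comp (modelMap f₁ N α α)) ?_ ?_ ?_ hx
  · rintro _ ⟨y, rfl⟩
    rw [MonoidHom.comp_apply, hj, ← lev_act]
    exact ⟨_, rfl⟩
  · have := NilCoprod.hom_ext (f := (QuotientGroup.mk' (W (im j q) 2)).comp ((act P α).comp η))
      (g := (QuotientGroup.mk' (W (im j q) 2)).comp (η'.comp (modelMap f₁ N α α)))
      (fun x => ?_) (fun y => ?_)
    · exact fun x => DFunLike.congr_fun this x
    · have h₁ := mk_map_eq_mk_map (act P α) (act_mem_im j α) (hi x)
      change ((act P α (η (modelInl f₁ N p p x)) : Level P q) : Level P q ⧸ W (im j q) 2) =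
        (η' (modelMap f₁ N α α (modelInl f₁ N p p x)) : _)
      rw [h₁, modelMap, NilCoprod.map_inl, hi', lev_act]
    · exact congrArg (QuotientGroup.mk' (W (im j q) 2)) (hj'' y)
  · rintro _ ⟨y, rfl⟩
    exact hj'' y

variable (hC : IsFreeMapOn f₁ C) (hD : IsFreeMapOn f₂ D)
include hC hD

/-- `θ` transports the boundary problem to the diagonal of `modelPiece`, and `η` brings the solution
back. Their failure to be simplicial on weight `w` lies in `W (w + 1)`, hence among the
decomposables. -/
lemma graded_exact {m n : ℕ} (hCm : ∀ q < m, C q = ∅) (hDn : ∀ q < n, D q = ∅) (w r : ℕ)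
    (hr : r < m + n) (x : Level P r) (hx : x ∈ W (im j r) w)
    (hx' : ∀ a, (nsimp P).FaceIn (fun q => decomposables (im i q) (im j q) w) a x) :
    ∃ v : Level P (r + 1), ((nsimp P).d r 0 v)⁻¹ * x ∈ decomposables (im i r) (im j r) w ∧
      ∀ a, 1 ≤ a → (nsimp P).d r a v ∈ decomposables (im i r) (im j r) w := by
  have hX : ∀ p q, p < m ∨ q < n → Subsingleton (ModelPiece f₁ f₂ w p q) := fun p q hpq =>
    modelPiece_subsingleton w p q (hpq.imp (fun hp => free_surjective hC (hCm p hp))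
      fun hq => free_surjective hD (hDn q hq))
  choose θ hθj hθC hθi hθM using exists_comparison h hC
  choose η hηj hηC hηi hηM using exists_inverse_comparison h hC
  have hηθ : ∀ q x, η q (θ q x) = x := by
    intro q
    have := desc_ext h (isNil_level P q) (χ := (η q).comp (θ q)) (χ' := MonoidHom.id _)
      (fun x => ?_) (fun y => ?_)
    · exact fun x => DFunLike.congr_fun this x
    · have := free_hom_ext hC (isNil_level P q) (ψ := ((η q).comp (θ q)).comp (lev i q))
        (ψ' := lev i q) (fun x => ?_) (fun c hc => ?_)
      · exact DFunLike.congr_fun this x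
      · simp only [MonoidHom.comp_apply]
        rw [← lev_comm h, hθj, hηj]
      · simp only [MonoidHom.comp_apply]
        rw [hθC q c hc, hηC q c hc]
    · rw [MonoidHom.comp_apply, hθj, hηj]
      rfl
  have hθl : ∀ q, ∀ x ∈ im i q, θ q x ∈ modelLeft f₁ f₂ q q := by
    rintro q _ ⟨x, rfl⟩
    exact hθM q x
  have hθr : ∀ q, ∀ x ∈ im j q, θ q x ∈ modelRight f₁ N q q := by
    rintro q _ ⟨y, rfl⟩
    rw [hθj]
    exact ⟨y, rfl⟩
  have hηr : ∀ q, ∀ x ∈ modelRight f₁ N q q, η q x ∈ im j q := by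
    rintro q _ ⟨y, rfl⟩
    rw [hηj]
    exact ⟨y, rfl⟩
  have hηl : ∀ q, ∀ x ∈ modelLeft f₁ f₂ q q, η q x ∈ im i q := by
    intro q
    change modelLeft f₁ f₂ q q ≤ (im i q).comap (η q)
    refine sup_le ?_ ?_
    · rintro _ ⟨x, rfl⟩
      exact hηM q x
    · rintro _ ⟨_, ⟨x, rfl⟩, rfl⟩
      change η q (modelInr f₁ N q q (lev f₂ q x)) ∈ im i q
      rw [hηj, lev_comm h]
      exact ⟨_, rfl⟩
  have hθx := map_mem_W (θ r) (hθr r) hx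
  obtain ⟨u, hu, hu'⟩ := (modelPiece f₁ f₂ w).exists_diag_boundary hX r hr
    (QuotientGroup.mk ⟨θ r x, hθx⟩) (fun a => by
      cases r with
      | zero => trivial
      | succ r =>
        refine BiSimp.diagFaceEqOne_ofMaps _ _ _ (fun a => ?_) a
        rw [modelPieceMap, GradedPiece.map_mk, GradedPiece.mk_eq_one]
        have h₁ := comparison_congr h (SimplexCategory.δ a) (hθj _) (hθj _) (hθi _) (hθi _) hx
        have h₂ : θ r (act P (SimplexCategory.δ a) x) ∈ decomposables (modelLeft f₁ f₂ r r)
            (modelRight f₁ N r r) w := by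
          refine map_mem_decomposables (θ r) (hθl r) (hθr r) ?_
          have := hx' a
          change (nsimp P).d r a x ∈ _ at this
          rwa [nsimp_d] at this
        have := mul_mem h₂ (le_decomposables (modelLeft f₁ f₂ r r) _ w (QuotientGroup.eq.1 h₁))
        rwa [mul_inv_cancel_left] at this)
  obtain ⟨⟨u, huW⟩, rfl⟩ := QuotientGroup.mk_surjective u
  have key : ∀ a : Fin (r + 2), ∃ e ∈ decomposables (im i r) (im j r) w,
      (nsimp P).d r a (η (r + 1) u) =
        η r (modelMap f₁ N (SimplexCategory.δ a) (SimplexCategory.δ a) u) * e := by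
    intro a
    have h₁ := inverse_comparison_congr (SimplexCategory.δ a) (hηj _) (hηj _) (hηi _) (hηi _) huW
    refine ⟨_, le_decomposables (im i r) _ w (QuotientGroup.eq.1 h₁.symm), ?_⟩
    rw [mul_inv_cancel_left, nsimp_d]
    rfl
  refine ⟨η (r + 1) u, ?_, fun a ha => ?_⟩
  · obtain ⟨e, he, h₁⟩ := key 0
    rw [modelPiece, BiSimp.ofMaps_d_d _ _ _ (Nat.zero_lt_succ _) (Nat.zero_lt_succ _),
      modelPieceMap, GradedPiece.map_mk, GradedPiece.mk_eq_mk] at hu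
    have h₂ := map_mem_decomposables (η r) (hηl r) (hηr r) hu
    rw [map_mul, map_inv, hηθ] at h₂
    have h₃ := mul_mem (inv_mem he) h₂
    rw [← mul_assoc, ← mul_inv_rev] at h₃
    have h₄ : (nsimp P).d r 0 (η (r + 1) u) = _ := h₁
    rw [h₄]
    exact h₃
  · rcases Nat.lt_or_ge a (r + 2) with hlt | hge
    · obtain ⟨e, he, h₁⟩ := key ⟨a, hlt⟩
      have hu'' := hu' a ha
      rw [modelPiece, BiSimp.ofMaps_d_d _ _ _ hlt hlt, modelPieceMap, GradedPiece.map_mk,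
        GradedPiece.mk_eq_one] at hu''
      have h₂ := map_mem_decomposables (η r) (hηl r) (hηr r) hu''
      have h₄ : (nsimp P).d r a (η (r + 1) u) = _ := h₁
      rw [h₄]
      exact mul_mem h₂ he
    · rw [(nsimp P).d_of_lt _ _ _ (by omega)]
      exact one_mem _

/-- The vanishing of the triad homotopy groups of a push-out. -/
theorem exists_isTriadChain {m n : ℕ} (hCm : ∀ q < m, C q = ∅) (hDn : ∀ q < n, D q = ∅) {r : ℕ}
    (hr : r + 1 < m + n) {x : Level P (r + 1)} (hx : (nsimp P).IsTriadCycle (im i) (im j) x) :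
    ∃ u : Level P (r + 2), (nsimp P).IsTriadChain (im i) (im j) u ∧ (nsimp P).d (r + 1) 2 u = x :=
  (filteredTriad h hC hD).exists_isTriadChain
    (fun w r hr x hx hx' => graded_exact h hC hD hCm hDn w r hr x hx hx') (K := 2 * k)
    (fun _ => W_one) (fun q => W_eq_bot (isNil_level P q)) hr hx

end

end SNil

/-! ## From triads to relative homotopy groups -/

namespace NSimp

variable {X : ℕ → Type*} [∀ n, Group (X n)] (S : NSimp X) {M N : ∀ n, Subgroup (X n)} {n : ℕ}

/-- A relative cycle modulo `M` can be moved into `N` if it bounds as a triad cycle. -/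
lemma exists_relCycle_of_isTriadChain (hM : S.IsSub M) {x : X (n + 1)}
    (hx : S.d n 0 x ∈ M n) (hx' : ∀ a, 1 ≤ a → S.d n a x = 1) {u : X (n + 2)}
    (hu : S.IsTriadChain M N u) (hux : S.d (n + 1) 2 u = x) :
    ∃ t ∈ N (n + 1), S.d n 0 t ∈ M n ∧ (∀ a, 1 ≤ a → S.d n a t = 1) ∧
      ∃ v : X (n + 2), S.d (n + 1) 0 v ∈ M (n + 1) ∧ S.d (n + 1) 1 v = t⁻¹ * x ∧
        ∀ a, 2 ≤ a → S.d (n + 1) a v = 1 := by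
  obtain ⟨h₀, h₁, h₂⟩ := hu
  -- The new cycle is `t = d_1 u`; correcting `u` by `s_1 x` makes its second face trivial and
  -- exhibits `t` as homologous to `x`.
  refine ⟨_, h₁, ?_, fun a ha => ?_, u⁻¹ * S.s (n + 1) 1 x, ?_, ?_, fun a ha => ?_⟩
  · rw [S.d_d n 0 0 u le_rfl]
    exact hM.d_mem _ _ _ h₀
  · rcases ha.eq_or_lt with rfl | ha
    · rw [← S.d_d n 1 1 u le_rfl, hux]
      exact hx' 1 le_rfl
    · rw [← S.d_d n 1 a u ha.le, h₂ _ (by omega), map_one]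
  · rw [map_mul, map_inv, S.d_s_of_le n 0 0 x le_rfl (Nat.zero_le n)]
    exact mul_mem (inv_mem h₀) (hM.s_mem _ _ _ hx)
  · rw [map_mul, map_inv, S.d_s_self _ _ _ (by omega)]
  · rcases ha.eq_or_lt with rfl | ha
    · rw [map_mul, map_inv, hux, S.d_s_succ _ _ _ (by omega), inv_mul_cancel]
    · obtain ⟨a, rfl⟩ := Nat.exists_eq_add_of_lt ha
      rw [map_mul, map_inv, h₂ _ (by omega), inv_one, one_mul]
      rcases Nat.eq_zero_or_pos n with rfl | hn
      · rw [S.d_of_lt]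
        omega
      · rw [show 2 + a + 1 = (a + 2) + 1 by omega, S.d_s_of_gt n _ 1 x (by omega) hn,
          hx' _ (by omega), map_one]

/-- A relative chain modulo `M` with first face in `N` can be moved into `N`, with the same first
face, if it bounds as a triad cycle. -/
lemma exists_relChain_of_isTriadChain (hM : S.IsSub M) {u : X (n + 1)} {z : X (n + 2)} (hz : S.IsTriadChain M N z)
    (hzu : S.d (n + 1) 2 z = u) :
    ∃ t ∈ N (n + 1), S.d n 0 t ∈ M n ∧ S.d n 1 t = S.d n 1 u ∧ ∀ a, 2 ≤ a → S.d n a t = 1 := by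
  obtain ⟨h₀, h₁, h₂⟩ := hz
  refine ⟨_, h₁, ?_, ?_, fun a ha => ?_⟩
  · rw [S.d_d n 0 0 z le_rfl]
    exact hM.d_mem _ _ _ h₀
  · rw [← S.d_d n 1 1 z le_rfl, hzu]
  · rw [← S.d_d n 1 a z (by omega), h₂ _ (by omega), map_one]

end NSimp

namespace SNil

open SGrp

variable {k : ℕ}

lemma lev_d {X Y : SNilCat.{u} k} (f : X ⟶ Y) (n a : ℕ) (x : Level X (n + 1)) :
    lev f n ((nsimp X).d n a x) = (nsimp Y).d n a (lev f (n + 1) x) := by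
  rcases Nat.lt_or_ge a (n + 2) with h | h
  · exact (congrArg (lev f n) (nsimp_d X ⟨a, h⟩ x)).trans
      ((app_face ((forget k).map f) n ⟨a, h⟩ x).trans (nsimp_d Y ⟨a, h⟩ _).symm)
  · rw [(nsimp X).d_of_lt _ _ _ (by omega), (nsimp Y).d_of_lt _ _ _ (by omega), map_one]

lemma forall_face_succ {X : SNilCat.{u} k} {n : ℕ} {x : Level X (n + 1)} :
    (∀ a : Fin (n + 1), face ((forget k).obj X) n a.succ x = 1) ↔
      ∀ a, 1 ≤ a → (nsimp X).d n a x = 1 := by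
  refine ⟨fun h a ha => ?_, fun h a => ?_⟩
  · obtain ⟨a, rfl⟩ := Nat.exists_eq_add_of_le' ha
    rcases Nat.lt_or_ge a (n + 1) with ha' | ha'
    · exact (nsimp_d X (Fin.succ ⟨a, ha'⟩) x).trans (h ⟨a, ha'⟩)
    · exact (nsimp X).d_of_lt _ _ _ (by omega)
  · rw [← nsimp_d]
    exact h _ (by simp)

lemma forall_face_succ_succ {X : SNilCat.{u} k} {n : ℕ} {x : Level X (n + 2)} :
    (∀ a : Fin (n + 1), face ((forget k).obj X) (n + 1) a.succ.succ x = 1) ↔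
      ∀ a, 2 ≤ a → (nsimp X).d (n + 1) a x = 1 := by
  refine ⟨fun h a ha => ?_, fun h a => ?_⟩
  · obtain ⟨a, rfl⟩ := Nat.exists_eq_add_of_le' ha
    rcases Nat.lt_or_ge a (n + 1) with ha' | ha'
    · exact (nsimp_d X (Fin.succ (Fin.succ ⟨a, ha'⟩)) x).trans (h ⟨a, ha'⟩)
    · exact (nsimp X).d_of_lt _ _ _ (by omega)
  · rw [← nsimp_d]
    exact h _ (by simp)

lemma face_zero {X : SNilCat.{u} k} {n : ℕ} (x : Level X (n + 1)) :
    face ((forget k).obj X) n 0 x = (nsimp X).d n 0 x := (nsimp_d X 0 x).symm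

lemma face_one {X : SNilCat.{u} k} {n : ℕ} (x : Level X (n + 1)) :
    face ((forget k).obj X) n 1 x = (nsimp X).d n 1 x := (nsimp_d X 1 x).symm

lemma mem_chains_iff {X : SNilCat.{u} k} {n : ℕ} {x : Level X (n + 1)} :
    x ∈ chains ((forget k).obj X) n ↔ ∀ a, 1 ≤ a → (nsimp X).d n a x = 1 :=
  mem_chains.trans forall_face_succ

/-- For injective `f` the second component is automatically a cycle, since `d_a d_0 x = d_0 d_{a+1}
x = 1`. In degree 0 there is no cycle condition, so the truncated `n - 1` is harmless. -/
lemma mem_relCycles_iff {X Y : SNilCat.{u} k} (f : X ⟶ Y) {n : ℕ} {x : Level Y (n + 1)}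
    {y : Level X n} (hf : Function.Injective (lev f (n - 1))) :
    (x, y) ∈ relCycles ((forget k).map f) n ↔
      (∀ a, 1 ≤ a → (nsimp Y).d n a x = 1) ∧ (nsimp Y).d n 0 x = lev f n y := by
  constructor
  · rintro ⟨h₁, h₂, -⟩
    exact ⟨forall_face_succ.1 h₁, (face_zero x).symm.trans h₂⟩
  · rintro ⟨h₁, h₂⟩
    refine ⟨forall_face_succ.2 h₁, (face_zero x).trans h₂, ?_⟩
    cases n with
    | zero => exact Subgroup.mem_top _
    | succ n =>
      refine mem_cycles_succ.2 fun a => ?_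
      rw [← nsimp_d]
      refine hf ?_
      change lev f n ((nsimp X).d n a y) = lev f n 1
      rw [map_one, lev_d, ← h₂, ← (nsimp Y).d_d n 0 a x (Nat.zero_le a),
        h₁ _ (by omega), map_one]

lemma mem_relChains_iff {X Y : SNilCat.{u} k} (f : X ⟶ Y) {n : ℕ} {x : Level Y (n + 2)}
    {y : Level X (n + 1)} (hf : Function.Injective (lev f n)) :
    (x, y) ∈ relChains ((forget k).map f) n ↔
      (∀ a, 2 ≤ a → (nsimp Y).d (n + 1) a x = 1) ∧ (nsimp Y).d (n + 1) 0 x = lev f (n + 1) y := by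
  constructor
  · rintro ⟨h₁, h₂, -⟩
    exact ⟨forall_face_succ_succ.1 h₁, (face_zero x).symm.trans h₂⟩
  · rintro ⟨h₁, h₂⟩
    refine ⟨forall_face_succ_succ.2 h₁, (face_zero x).trans h₂, mem_chains_iff.2 fun a ha => ?_⟩
    refine hf ?_
    rw [map_one, lev_d, ← h₂, ← (nsimp Y).d_d n 0 a x (Nat.zero_le a), h₁ _ (by omega), map_one]

lemma mem_relBoundaries_iff {X Y : SNilCat.{u} k} (f : X ⟶ Y) {n : ℕ} {x : Level Y (n + 1)}
    {y : Level X n} (hf : Function.Injective (lev f n))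
    (hxy : (nsimp Y).d n 0 x = lev f n y) :
    (x, y) ∈ relBoundaries ((forget k).map f) n ↔
      ∃ u : Level Y (n + 2), (nsimp Y).d (n + 1) 0 u ∈ im f (n + 1) ∧ (nsimp Y).d (n + 1) 1 u = x ∧
        ∀ a, 2 ≤ a → (nsimp Y).d (n + 1) a u = 1 := by
  constructor
  · rintro ⟨⟨u, v⟩, huv, e⟩
    obtain ⟨h₁, h₂⟩ := (mem_relChains_iff f hf).1 huv
    exact ⟨u, ⟨v, h₂.symm⟩, (face_one u).symm.trans (congrArg Prod.fst e), h₁⟩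
  · rintro ⟨u, ⟨v, hv⟩, hux, hu⟩
    refine ⟨(u, v), (mem_relChains_iff f hf).2 ⟨hu, hv.symm⟩, ?_⟩
    refine Prod.ext ((face_one u).trans hux) ((face_zero v).trans (hf ?_))
    rw [lev_d, hv, ← (nsimp Y).d_d n 0 0 u le_rfl, hux, hxy]

section

variable {F M N P : SNilCat.{u} k} {f₁ : F ⟶ M} {f₂ : F ⟶ N} {i : M ⟶ P} {j : N ⟶ P}
  {C : ∀ q : ℕ, Set (Level M q)} {D : ∀ q : ℕ, Set (Level N q)}

lemma free_injective (hC : IsFreeMapOn f₁ C) (q : ℕ) : Function.Injective (lev f₁ q) := by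
  obtain ⟨ρ, hρ⟩ := free_exists_retraction hC q
  exact Function.LeftInverse.injective hρ

variable (h : IsPushout f₂ f₁ j i)
include h

lemma lev_left_injective (hD : IsFreeMapOn f₂ D) (q : ℕ) : Function.Injective (lev i q) := by
  obtain ⟨ρ, hρ, -⟩ := exists_retraction_left h hD q
  exact Function.LeftInverse.injective hρ

lemma lev_right_injective (hC : IsFreeMapOn f₁ C) (q : ℕ) : Function.Injective (lev j q) := by
  obtain ⟨ρ, hρ, -⟩ := exists_retraction_right h hC q
  exact Function.LeftInverse.injective hρ

/-- Inside P, the intersection of M and N is F: the retraction onto N sends M to F. -/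
lemma mem_im_of_lev_mem_im (hC : IsFreeMapOn f₁ C) {q : ℕ} {y : Level N q}
    (hy : lev j q y ∈ im i q) : y ∈ im f₂ q := by
  obtain ⟨ρ, h₁, h₂⟩ := exists_retraction_right h hC q
  obtain ⟨x, hx⟩ := hy
  rw [← h₁ y, ← hx]
  exact h₂ x

lemma lev_left_surjective (hD : IsFreeMapOn f₂ D) {q : ℕ}
    (hq : Function.Surjective (lev f₂ q)) : Function.Surjective (lev i q) := by
  obtain ⟨ρ, hρ, -⟩ := exists_retraction_left h hD q
  have e := desc_ext h (isNil_level P q) (χ := (lev i q).comp ρ) (χ' := MonoidHom.id _)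
    (fun x => congrArg (lev i q) (hρ x)) (fun y => by
      obtain ⟨x, rfl⟩ := hq y
      rw [lev_comm h]
      exact congrArg (lev i q) (hρ _))
  exact fun x => ⟨ρ x, DFunLike.congr_fun e x⟩

variable (hC : IsFreeMapOn f₁ C) (hD : IsFreeMapOn f₂ D) {m n : ℕ} (hCm : ∀ q < m, C q = ∅)
  (hDn : ∀ q < n, D q = ∅)
include hC hD hCm hDn

/-- A relative cycle is a triad cycle of degree `r + 1` whose first face is trivial. -/
theorem relHomotopyGroupMap_surjective {r : ℕ} (hr : r + 1 < m + n) :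
    Function.Surjective (relHomotopyGroupMap (h.toCommSq.map (forget k)) r) := by
  intro c
  obtain ⟨⟨⟨x, y⟩, hxy⟩, rfl⟩ := QuotientGroup.mk_surjective c
  have hi := lev_left_injective h hD
  obtain ⟨hx, hx₀⟩ := (mem_relCycles_iff i (hi _)).1 hxy
  have hx₀' : (nsimp P).d r 0 x ∈ im i r := ⟨y, hx₀.symm⟩
  obtain ⟨u, hu, hux⟩ := exists_isTriadChain h hC hD hCm hDn hr (x := x)
    ⟨hx₀', by rw [hx 1 le_rfl]; exact one_mem _, fun a ha => hx a (by omega)⟩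
  obtain ⟨_, ⟨t, rfl⟩, ht₀, ht, v, hv₀, hv₁, hv⟩ :=
    (nsimp P).exists_relCycle_of_isTriadChain (isSub_im i) hx₀' hx hu hux
  rw [← lev_d] at ht₀
  obtain ⟨z, hz⟩ := mem_im_of_lev_mem_im h hC ht₀
  have htz : (t, z) ∈ relCycles ((forget k).map f₂) r :=
    (mem_relCycles_iff f₂ (free_injective hD _)).2 ⟨fun a ha => lev_right_injective h hC _ (by
      rw [lev_d, ht a ha, map_one]), hz.symm⟩
  refine ⟨QuotientGroup.mk ⟨(t, z), htz⟩, QuotientGroup.eq.2 (Subgroup.mem_subgroupOf.2 ?_)⟩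
  change ((lev j (r + 1) t)⁻¹ * x, (lev f₁ r z)⁻¹ * y) ∈ relBoundaries ((forget k).map i) r
  refine (mem_relBoundaries_iff i (hi r) ?_).2 ⟨v, hv₀, hv₁, hv⟩
  rw [map_mul, map_mul, map_inv, map_inv, ← lev_d, ← hz, lev_comm h, hx₀]

/-- A chain in (P, M) bounding a cycle from N is itself a triad cycle, of degree `r + 2`. -/
theorem relHomotopyGroupMap_injective {r : ℕ} (hr : r + 2 < m + n) :
    Function.Injective (relHomotopyGroupMap (h.toCommSq.map (forget k)) r) := by
  rw [injective_iff_map_eq_one]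
  intro c hc
  obtain ⟨⟨⟨x, y⟩, hxy⟩, rfl⟩ := QuotientGroup.mk_surjective c
  obtain ⟨hx, hx₀⟩ := (mem_relCycles_iff f₂ (free_injective hD _)).1 hxy
  have hc' := Subgroup.mem_subgroupOf.1 ((QuotientGroup.eq_one_iff _).1 hc)
  change (lev j (r + 1) x, lev f₁ r y) ∈ relBoundaries ((forget k).map i) r at hc'
  obtain ⟨u, hu₀, hu₁, hu⟩ := (mem_relBoundaries_iff i (lev_left_injective h hD r)
    (by rw [← lev_d, hx₀, lev_comm h])).1 hc'
  obtain ⟨z, hz, hzu⟩ := exists_isTriadChain h hC hD hCm hDn hr (x := u)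
    ⟨hu₀, ⟨x, hu₁.symm⟩, hu⟩
  obtain ⟨_, ⟨t, rfl⟩, ht₀, ht₁, ht⟩ :=
    (nsimp P).exists_relChain_of_isTriadChain (isSub_im i) hz hzu
  rw [← lev_d] at ht₀
  have hj := lev_right_injective h hC
  refine (QuotientGroup.eq_one_iff _).2 (Subgroup.mem_subgroupOf.2 ?_)
  refine (mem_relBoundaries_iff f₂ (free_injective hD r) hx₀).2
    ⟨t, mem_im_of_lev_mem_im h hC ht₀, hj _ ?_, fun a ha => hj _ ?_⟩
  · rw [lev_d, ht₁, hu₁]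
  · rw [lev_d, ht a ha, map_one]

theorem relPiZeroMap_injective (hmn : 1 < m + n) :
    Function.Injective (relPiZeroMap (h.toCommSq.map (forget k))) := by
  intro c c' hcc
  obtain ⟨c, rfl⟩ := QuotientGroup.mk_surjective c
  obtain ⟨c', rfl⟩ := QuotientGroup.mk_surjective c'
  obtain ⟨⟨x, hx⟩, rfl⟩ := QuotientGroup.mk_surjective c
  obtain ⟨⟨x', hx'⟩, rfl⟩ := QuotientGroup.mk_surjective c'
  obtain ⟨μ, hμ⟩ := QuotientGroup.eq.1 hcc
  obtain ⟨⟨μ, hμ'⟩, rfl⟩ := QuotientGroup.mk_surjective μ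
  obtain ⟨w, hw, hwμ⟩ := Subgroup.mem_subgroupOf.1 (QuotientGroup.eq.1 hμ)
  have hw' := mem_chains_iff.1 hw
  change face _ _ _ w = (lev i 0 μ)⁻¹ * ((lev j 0 x)⁻¹ * lev j 0 x') at hwμ
  rw [face_zero, ← map_inv (lev j 0), ← map_mul (lev j 0)] at hwμ
  -- This 1-simplex joins the class from N, as its first face, to `μ` from M, as its zeroth, so it
  -- is a triad cycle of degree 1.
  have hu₁ : (nsimp P).d 0 1 ((nsimp P).s 0 0 (lev j 0 (x⁻¹ * x')) * w⁻¹) =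
      lev j 0 (x⁻¹ * x') := by
    rw [map_mul, map_inv, hw' 1 le_rfl, (nsimp P).d_s_succ _ _ _ le_rfl, inv_one, mul_one]
  obtain ⟨z, hz, hzu⟩ := exists_isTriadChain h hC hD hCm hDn (r := 0) (by omega)
    (x := (nsimp P).s 0 0 (lev j 0 (x⁻¹ * x')) * w⁻¹)
    ⟨⟨μ, by
      rw [map_mul, map_inv, hwμ, (nsimp P).d_s_self _ _ _ le_rfl, mul_inv_rev, inv_inv,
        mul_inv_cancel_left]⟩, ⟨_, hu₁.symm⟩,
      fun a ha => (nsimp P).d_of_lt _ _ _ (by omega)⟩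
  obtain ⟨_, ⟨t, rfl⟩, ht₀, ht₁, -⟩ :=
    (nsimp P).exists_relChain_of_isTriadChain (isSub_im i) hz hzu
  rw [hu₁, ← lev_d] at ht₁
  rw [← lev_d] at ht₀
  have ht₁' := lev_right_injective h hC _ ht₁
  obtain ⟨ν, hν⟩ := mem_im_of_lev_mem_im h hC ht₀
  refine QuotientGroup.eq.2 ⟨QuotientGroup.mk ⟨ν, Subgroup.mem_top _⟩,
    QuotientGroup.eq.2 (Subgroup.mem_subgroupOf.2
      ⟨t⁻¹ * (nsimp N).s 0 0 (x⁻¹ * x'), mem_chains_iff.2 fun a ha => ?_, ?_⟩)⟩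
  · rcases ha.eq_or_lt with rfl | ha
    · rw [map_mul, map_inv, ht₁', (nsimp N).d_s_succ _ _ _ le_rfl, inv_mul_cancel]
    · exact (nsimp N).d_of_lt _ _ _ (by omega)
  · change face _ _ _ _ = (lev f₂ 0 ν)⁻¹ * (x⁻¹ * x')
    rw [face_zero, map_mul, map_inv, (nsimp N).d_s_self _ _ _ le_rfl, hν]

theorem relPiZeroMap_surjective (hmn : 0 < m + n) :
    Function.Surjective (relPiZeroMap (h.toCommSq.map (forget k))) := by
  intro c
  obtain ⟨c, rfl⟩ := QuotientGroup.mk_surjective c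
  obtain ⟨⟨x, hx⟩, rfl⟩ := QuotientGroup.mk_surjective c
  -- Either `m > 0` and P_0 comes from N_0, or `n > 0` and P_0 comes from M_0, leaving a single
  -- coset.
  rcases Nat.eq_zero_or_pos n with rfl | hn
  · obtain ⟨y, rfl⟩ := lev_left_surjective h.flip hC (free_surjective hC (hCm 0 hmn)) x
    exact ⟨QuotientGroup.mk (QuotientGroup.mk ⟨y, Subgroup.mem_top _⟩), rfl⟩
  · obtain ⟨y, rfl⟩ := lev_left_surjective h hD (free_surjective hD (hDn 0 hn)) x
    refine ⟨QuotientGroup.mk 1, QuotientGroup.eq.2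
      ⟨QuotientGroup.mk ⟨y, Subgroup.mem_top _⟩, ?_⟩⟩
    rw [map_one, inv_one, one_mul]
    rfl

end

end SNil

theorem mainTheorem7 (k : ℕ) (hk : 1 ≤ k) (m n : ℕ) {F M N P : SNil.SNilCat.{u} k}
    (hF : SNil.IsCofibrant F)
    (f₁ : F ⟶ M) (f₂ : F ⟶ N) (hf₁ : SNil.AttachesCells m f₁) (hf₂ : SNil.AttachesCells n f₂)
    (i : M ⟶ P) (j : N ⟶ P) (h : IsPushout f₂ f₁ j i) :
    (∀ r : ℕ, (r + 1) + 2 ≤ n + m →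
      Function.Bijective (SGrp.relHomotopyGroupMap (h.toCommSq.map (SNil.forget k)) r)) ∧
    (∀ r : ℕ, (r + 1) + 1 = n + m →
      Function.Surjective (SGrp.relHomotopyGroupMap (h.toCommSq.map (SNil.forget k)) r)) ∧
    (2 ≤ n + m →
      Function.Bijective (SGrp.relPiZeroMap (h.toCommSq.map (SNil.forget k)))) ∧
    (n + m = 1 →
      Function.Surjective (SGrp.relPiZeroMap (h.toCommSq.map (SNil.forget k)))) := by
  obtain ⟨C, hC, hCm⟩ := hf₁
  obtain ⟨D, hD, hDn⟩ := hf₂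
  exact ⟨fun r hr => ⟨SNil.relHomotopyGroupMap_injective h hC hD hCm hDn (by omega),
      SNil.relHomotopyGroupMap_surjective h hC hD hCm hDn (by omega)⟩,
    fun r hr => SNil.relHomotopyGroupMap_surjective h hC hD hCm hDn (by omega),
    fun hmn => ⟨SNil.relPiZeroMap_injective h hC hD hCm hDn (by omega),
      SNil.relPiZeroMap_surjective h hC hD hCm hDn (by omega)⟩,
    fun hmn => SNil.relPiZeroMap_surjective h hC hD hCm hDn (by omega)⟩
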